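/- Let $(M,L)$ be a Finsler manifold of dimension $n\ge 3$ ($L$ is positive, smooth and positively homogeneous of degree one on the nonzero tangent vectors, with positive definite metric $g=\frac12\,\partial^2L^2/\partial y^i\partial y^j$). Let $\nabla$ be its Cartan connection on the pullback bundle $\pi^{-1}(TM)$ over the nonzero tangent vectors, $\beta$ the horizontal lift, $\stackrel{h}{\nabla}$ the horizontal covariant derivative $\nabla_{\beta}$, and $R$ the h-curvature, $R(X,Y)Z=-\nabla_{\beta X}\nabla_{\beta Y}Z+\nabla_{\beta Y}\nabla_{\beta X}Z+\nabla_{[\beta X,\beta Y]}Z$. Put $\mathrm{Ric}(X,Y)=\mathrm{Tr}(Z\mapsto R(X,Z)Y)$, let $r$ be the $g$-trace of $\mathrm{Ric}$, and let $C=R-\frac{r}{n(n-1)}G$ be the concircular curvature, where $G(X,Y)Z=g(X,Z)Y-g(Y,Z)X$. A scalar 1-form (resp. 2-form) is a smooth field of linear (resp. bilinear) forms on $\pi^{-1}(TM)$, positively homogeneous of degree zero in $y$; 2-forms need not be skew. "Non-zero" means not identically zero. The manifold $(M,L)$ is called * recurrent with recurrence form $A$ if $R\neq0$ and $\stackrel{h}{\nabla}R=A\otimes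 R$ for the non-zero scalar 1-form $A$; * 2-recurrent if $R\neq0$ and $\stackrel{h}{\nabla}\stackrel{h}{\nabla}R=\alpha\otimes R$ for a non-zero scalar 2-form $\alpha$. Ricci recurrent and 2-Ricci recurrent manifolds are defined in the same way, with $\mathrm{Ric}$ in place of $R$, for manifolds with $\mathrm{Ric}\neq0$. Concircularly recurrent manifolds are defined in the same way as recurrent ones, with $C$ in place of $R$, for manifolds with $C\neq0$. Theorem. Suppose that $(M,L)$ is recurrent with recurrence form $A$. (a) If $\mathrm{Ric}\ne0$ (so that the notion is defined), then $(M,L)$ is Ricci recurrent, with recurrence form $A$. (b) If $r\neq0$ and $C\neq0$ (so that the notion is defined), then $(M,L)$ is concircularly recurrent, with recurrence form $A$. (c) If $\stackrel{h}{\nabla}A+A\otimes A\neq0$, then there is a non-zero scalar 2-form $\alpha$ such that $(M,L)$ is 2-recurrent with recurrence form $\alpha$ and, if $\mathrm{Ric}\neq0$, also 2-Ricci recurrent with recurrence form $\alpha$. -/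

import Mathlib

open scoped Manifold ContDiff

noncomputable section

namespace Finsler

/-! ## Local calculus of the Cartan connection

In a chart of the `n`-manifold `M`, the induced coordinates of `TM` are pairs `z = (x, y)`.
All components below are real functions of `z`. They are built from the local expression
`F (x, y)` of the fundamental function and are used where `y ≠ 0`. -/

/-- The coordinate space `ℝⁿ`. -/
abbrev Coord (n : ℕ) := EuclideanSpace ℝ (Fin n)

variable {n : ℕ}

/-- The `i`-th coordinate vector. -/
def coordVec (i : Fin n) : Coord n := EuclideanSpace.single i 1

/-- `∂f/∂xⁱ`. -/
def dX (i : Fin n) (f : Coord n × Coord n → ℝ) (z : Coord n × Coord n) : ℝ :=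
  fderiv ℝ f z (coordVec i, 0)

/-- `∂f/∂yⁱ`. -/
def dY (i : Fin n) (f : Coord n × Coord n → ℝ) (z : Coord n × Coord n) : ℝ :=
  fderiv ℝ f z (0, coordVec i)

/-- The Finsler metric `g_{ij} = ½ ∂²F²/∂yⁱ∂yʲ`. -/
def metric (F : Coord n × Coord n → ℝ) (i j : Fin n) (z : Coord n × Coord n) : ℝ :=
  (1 / 2) * dY i (dY j (fun w => F w ^ 2)) z

/-- The inverse metric `g^{ij}`. -/
def metricInv (F : Coord n × Coord n → ℝ) (i j : Fin n) (z : Coord n × Coord n) : ℝ :=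
  (Matrix.of fun a b => metric F a b z)⁻¹ i j

/-- The Cartan tensor `C_{ijk} = ½ ∂g_{ij}/∂yᵏ`. -/
def cartanLow (F : Coord n × Coord n → ℝ) (i j k : Fin n) (z : Coord n × Coord n) : ℝ :=
  (1 / 2) * dY k (metric F i j) z

/-- The vertical coefficients `Cⁱ_{jk} = g^{il} C_{ljk}` of the Cartan connection
(the components of its (h)hv-torsion). -/
def vertCoeff (F : Coord n × Coord n → ℝ) (i j k : Fin n) (z : Coord n × Coord n) : ℝ :=
  ∑ l, metricInv F i l z * cartanLow F l j k z

/-- The coefficients `Gⁱ = ¼ g^{il} (yᵏ ∂²F²/∂xᵏ∂yˡ - ∂F²/∂xˡ)` of the canonical spray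
(the geodesics are given by `ẍⁱ + 2 Gⁱ(x, ẋ) = 0`). -/
def spray (F : Coord n × Coord n → ℝ) (i : Fin n) (z : Coord n × Coord n) : ℝ :=
  (1 / 4) * ∑ l, metricInv F i l z *
    ((∑ k, z.2 k * dX k (dY l (fun w => F w ^ 2)) z) - dX l (fun w => F w ^ 2) z)

/-- The nonlinear connection `Nⁱ_j = ∂Gⁱ/∂yʲ`. -/
def nonlin (F : Coord n × Coord n → ℝ) (i j : Fin n) (z : Coord n × Coord n) : ℝ :=
  dY j (spray F i) z

/-- The horizontal derivative `δ_j f = ∂f/∂xʲ - Nᵏ_j ∂f/∂yᵏ`. -/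
def delta (F : Coord n × Coord n → ℝ) (j : Fin n) (f : Coord n × Coord n → ℝ)
    (z : Coord n × Coord n) : ℝ :=
  dX j f z - ∑ k, nonlin F k j z * dY k f z

/-- The horizontal coefficients
`Γⁱ_{jk} = ½ g^{il} (δ_j g_{lk} + δ_k g_{jl} - δ_l g_{jk})` of the Cartan connection. -/
def horCoeff (F : Coord n × Coord n → ℝ) (i j k : Fin n) (z : Coord n × Coord n) : ℝ :=
  (1 / 2) * ∑ l, metricInv F i l z *
    (delta F j (metric F l k) z + delta F k (metric F j l) z - delta F l (metric F j k) z)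

/-- The curvature `Rⁱ_{jk} = δ_k Nⁱ_j - δ_j Nⁱ_k` of the horizontal distribution,
`[δ_j, δ_k] = Rⁱ_{jk} ∂/∂yⁱ`. -/
def nonlinCurv (F : Coord n × Coord n → ℝ) (i j k : Fin n) (z : Coord n × Coord n) : ℝ :=
  delta F k (nonlin F i j) z - delta F j (nonlin F i k) z

/-- Components of a tensor field of type `(0, s)` on the pullback bundle. -/
abbrev LowComp (n s : ℕ) := (Fin s → Fin n) → Coord n × Coord n → ℝ

/-- Components of a tensor field of type `(1, s)` on the pullback bundle; the first argument is
the upper index. -/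
abbrev MixComp (n s : ℕ) := Fin n → (Fin s → Fin n) → Coord n × Coord n → ℝ

/-- The h-curvature tensor `R` of the Cartan connection: `hCurv F i ![j, k, h]` is the `i`-th
component of `R(∂_j, ∂_k)∂_h`, with the sign convention
`R(X, Y)Z = -∇_{βX}∇_{βY}Z + ∇_{βY}∇_{βX}Z + ∇_{[βX, βY]}Z`, `β` the horizontal lift. -/
def hCurv (F : Coord n × Coord n → ℝ) : MixComp n 3 := fun i J z =>
  delta F (J 1) (horCoeff F i (J 2) (J 0)) z - delta F (J 0) (horCoeff F i (J 2) (J 1)) z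
    + ∑ m, (horCoeff F m (J 2) (J 0) z * horCoeff F i m (J 1) z
      - horCoeff F m (J 2) (J 1) z * horCoeff F i m (J 0) z)
    + ∑ m, vertCoeff F i (J 2) m z * nonlinCurv F m (J 0) (J 1) z

/-- The horizontal Ricci tensor `Ric(X, Y) = Tr (Z ↦ R(X, Z)Y)`. -/
def ric (F : Coord n × Coord n → ℝ) : LowComp n 2 := fun J z =>
  ∑ k, hCurv F k ![J 0, k, J 1] z

/-- The horizontal scalar curvature `r`, the `g`-trace of `Ric`. -/
def scal (F : Coord n × Coord n → ℝ) (z : Coord n × Coord n) : ℝ :=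
  ∑ i, ∑ j, metricInv F i j z * ric F ![i, j] z

/-- The tensor `G(X, Y)Z = g(X, Z)Y - g(Y, Z)X`, with the index order of `hCurv`. -/
def gTensor (F : Coord n × Coord n → ℝ) : MixComp n 3 := fun i J z =>
  metric F (J 0) (J 2) z * (if i = J 1 then 1 else 0)
    - metric F (J 1) (J 2) z * (if i = J 0 then 1 else 0)

/-- The concircular curvature tensor `C = R - r / (n (n - 1)) G`. -/
def concirc (F : Coord n × Coord n → ℝ) : MixComp n 3 := fun i J z =>
  hCurv F i J z - scal F z / ((n : ℝ) * ((n : ℝ) - 1)) * gTensor F i J z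

/-- The h-covariant derivative of a tensor field of type `(0, s)`. The new index comes first:
`(∇ʰT)(W, X₁, …, X_s) = (∇_{βW} T)(X₁, …, X_s)`. -/
def hCovLow (F : Coord n × Coord n → ℝ) {s : ℕ} (T : LowComp n s) : LowComp n (s + 1) :=
  fun J z => delta F (J 0) (T (Fin.tail J)) z
    - ∑ a : Fin s, ∑ m, horCoeff F m (Fin.tail J a) (J 0) z
        * T (Function.update (Fin.tail J) a m) z

/-- The h-covariant derivative of a tensor field of type `(1, s)`. The new index comes first. -/
def hCovMix (F : Coord n × Coord n → ℝ) {s : ℕ} (T : MixComp n s) : MixComp n (s + 1) :=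
  fun i J z => delta F (J 0) (T i (Fin.tail J)) z
    + ∑ m, horCoeff F i m (J 0) z * T m (Fin.tail J) z
    - ∑ a : Fin s, ∑ m, horCoeff F m (Fin.tail J a) (J 0) z
        * T i (Function.update (Fin.tail J) a m) z

/-! ## Finsler manifolds -/

section Global

variable {M : Type*} [TopologicalSpace M] [ChartedSpace (Coord n) M]

/-- The smooth charts of `M`. -/
abbrev Charts (n : ℕ) (M : Type*) [TopologicalSpace M] [ChartedSpace (Coord n) M] :
    Set (OpenPartialHomeomorph M (Coord n)) :=
  IsManifold.maximalAtlas (𝓡 n) ∞ M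

/-- The coordinates `(x, y)`, `y ≠ 0`, of the nonzero tangent vectors over a chart domain. -/
def slit (e : OpenPartialHomeomorph M (Coord n)) : Set (Coord n × Coord n) :=
  e.target ×ˢ {y | y ≠ 0}

/-- The tangent vector `yⁱ ∂/∂xⁱ` at the point with coordinates `x` in the chart `e`. -/
def chartVec (e : OpenPartialHomeomorph M (Coord n)) (x y : Coord n) :
    TangentSpace (𝓡 n) (e.symm x) :=
  mfderiv 𝓘(ℝ, Coord n) (𝓡 n) e.symm x y

/-- The expression of a function on `TM` in the coordinates of `TM` induced by `e`. -/
def localExpr (L : TangentBundle (𝓡 n) M → ℝ) (e : OpenPartialHomeomorph M (Coord n))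
    (z : Coord n × Coord n) : ℝ :=
  L ⟨e.symm z.1, chartVec e z.1 z.2⟩

/-- A Finsler structure on `M`: a function on `TM`, positive and smooth on the nonzero vectors,
positively homogeneous of degree one, whose metric `g` is positive definite. (Homogeneity gives
`L 0 = 0`, and continuity of `L` along the zero section follows.) -/
structure FinslerStructure (n : ℕ) (M : Type*) [TopologicalSpace M]
    [ChartedSpace (Coord n) M] where
  /-- The fundamental function. -/
  L : TangentBundle (𝓡 n) M → ℝ
  pos : ∀ (x : M) (y : TangentSpace (𝓡 n) x), y ≠ 0 → 0 < L ⟨x, y⟩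
  homog : ∀ (x : M) (y : TangentSpace (𝓡 n) x) (c : ℝ), 0 < c → L ⟨x, c • y⟩ = c * L ⟨x, y⟩
  smooth : ∀ e ∈ Charts n M, ContDiffOn ℝ ∞ (localExpr L e) (slit e)
  posDef : ∀ e ∈ Charts n M, ∀ z ∈ slit e, ∀ v : Fin n → ℝ, v ≠ 0 →
    0 < ∑ i, ∑ j, metric (localExpr L e) i j z * v i * v j

/-- A scalar `s`-form on `TM`: a smooth field of type `(0, s)` on the pullback over the nonzero
tangent vectors of the tangent bundle (an `s`-linear form on `T_x M` for every `y ∈ T_x M`,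
`y ≠ 0`; no symmetry is required), positively homogeneous of degree zero in `y`.
The values at `y = 0` are irrelevant. -/
structure PiForm (n : ℕ) (M : Type*) [TopologicalSpace M] [ChartedSpace (Coord n) M]
    (s : ℕ) where
  /-- The form at the tangent vector `y` at `x`. -/
  toFun : ∀ x : M, TangentSpace (𝓡 n) x →
    MultilinearMap ℝ (fun _ : Fin s => TangentSpace (𝓡 n) x) ℝ
  homog : ∀ (x : M) (y : TangentSpace (𝓡 n) x) (c : ℝ), y ≠ 0 → 0 < c →
    toFun x (c • y) = toFun x y
  smooth : ∀ e ∈ Charts n M, ∀ J : Fin s → Fin n,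
    ContDiffOn ℝ ∞ (fun z : Coord n × Coord n => toFun (e.symm z.1) (chartVec e z.1 z.2)
      (fun a => chartVec e z.1 (coordVec (J a)))) (slit e)

/-- The components of a form in a chart. -/
def PiForm.comp {s : ℕ} (A : PiForm n M s) (e : OpenPartialHomeomorph M (Coord n)) :
    LowComp n s := fun J z =>
  A.toFun (e.symm z.1) (chartVec e z.1 z.2) (fun a => chartVec e z.1 (coordVec (J a)))

/-- The form does not vanish identically. -/
def PiForm.NonZero {s : ℕ} (A : PiForm n M s) : Prop :=
  ∃ (x : M) (y : TangentSpace (𝓡 n) x), y ≠ 0 ∧ A.toFun x y ≠ 0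

namespace FinslerStructure

variable (F : FinslerStructure n M)

/-- The local expression of the fundamental function in a chart. -/
def loc (e : OpenPartialHomeomorph M (Coord n)) : Coord n × Coord n → ℝ := localExpr F.L e

/-- The h-curvature tensor `R` does not vanish identically. -/
def CurvNonZero : Prop :=
  ∃ e ∈ Charts n M, ∃ z ∈ slit e, ∃ i J, hCurv (F.loc e) i J z ≠ 0

/-- The horizontal Ricci tensor does not vanish identically. -/
def RicNonZero : Prop :=
  ∃ e ∈ Charts n M, ∃ z ∈ slit e, ∃ J, ric (F.loc e) J z ≠ 0

/-- The horizontal scalar curvature does not vanish identically. -/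
def ScalNonZero : Prop :=
  ∃ e ∈ Charts n M, ∃ z ∈ slit e, scal (F.loc e) z ≠ 0

/-- The concircular curvature tensor does not vanish identically. -/
def ConcircNonZero : Prop :=
  ∃ e ∈ Charts n M, ∃ z ∈ slit e, ∃ i J, concirc (F.loc e) i J z ≠ 0

/-- `∇ʰA + A ⊗ A` does not vanish identically. -/
def CovAddSqNonZero (A : PiForm n M 1) : Prop :=
  ∃ e ∈ Charts n M, ∃ z ∈ slit e, ∃ i j,
    hCovLow (F.loc e) (A.comp e) ![i, j] z + A.comp e ![i] z * A.comp e ![j] z ≠ 0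

/-- Recurrent with recurrence form `A`: `R ≠ 0`, `A ≠ 0` and `∇ʰR = A ⊗ R`. -/
structure IsRecurrent (A : PiForm n M 1) : Prop where
  dim : 3 ≤ n
  curv_ne : F.CurvNonZero
  form_ne : A.NonZero
  eq : ∀ e ∈ Charts n M, ∀ z ∈ slit e, ∀ i l J,
    hCovMix (F.loc e) (hCurv (F.loc e)) i (Fin.cons l J) z
      = A.comp e ![l] z * hCurv (F.loc e) i J z

/-- 2-recurrent with recurrence form `α`: `R ≠ 0`, `α ≠ 0` and `∇ʰ∇ʰR = α ⊗ R`. -/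
structure IsTwoRecurrent (α : PiForm n M 2) : Prop where
  dim : 3 ≤ n
  curv_ne : F.CurvNonZero
  form_ne : α.NonZero
  eq : ∀ e ∈ Charts n M, ∀ z ∈ slit e, ∀ i k l J,
    hCovMix (F.loc e) (hCovMix (F.loc e) (hCurv (F.loc e))) i (Fin.cons k (Fin.cons l J)) z
      = α.comp e ![k, l] z * hCurv (F.loc e) i J z

/-- Ricci recurrent with recurrence form `A`: `Ric ≠ 0`, `A ≠ 0` and `∇ʰRic = A ⊗ Ric`. -/
structure IsRicciRecurrent (A : PiForm n M 1) : Prop where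
  dim : 3 ≤ n
  ric_ne : F.RicNonZero
  form_ne : A.NonZero
  eq : ∀ e ∈ Charts n M, ∀ z ∈ slit e, ∀ l J,
    hCovLow (F.loc e) (ric (F.loc e)) (Fin.cons l J) z = A.comp e ![l] z * ric (F.loc e) J z

/-- 2-Ricci recurrent with recurrence form `α`: `Ric ≠ 0`, `α ≠ 0` and `∇ʰ∇ʰRic = α ⊗ Ric`. -/
structure IsTwoRicciRecurrent (α : PiForm n M 2) : Prop where
  dim : 3 ≤ n
  ric_ne : F.RicNonZero
  form_ne : α.NonZero
  eq : ∀ e ∈ Charts n M, ∀ z ∈ slit e, ∀ k l J,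
    hCovLow (F.loc e) (hCovLow (F.loc e) (ric (F.loc e))) (Fin.cons k (Fin.cons l J)) z
      = α.comp e ![k, l] z * ric (F.loc e) J z

/-- Concircularly recurrent with recurrence form `A`: `C ≠ 0`, `A ≠ 0` and `∇ʰC = A ⊗ C`. -/
structure IsConcircRecurrent (A : PiForm n M 1) : Prop where
  dim : 3 ≤ n
  concirc_ne : F.ConcircNonZero
  form_ne : A.NonZero
  eq : ∀ e ∈ Charts n M, ∀ z ∈ slit e, ∀ i l J,
    hCovMix (F.loc e) (concirc (F.loc e)) i (Fin.cons l J) z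
      = A.comp e ![l] z * concirc (F.loc e) i J z

end FinslerStructure

end Global

end Finsler

end

/-! The horizontal covariant derivative satisfies the Leibniz rule, commutes with contractions, and
annihilates both the identity tensor and, the Cartan connection being metric, `g`. Everything in (a)
and (b) follows. Contracting `∇ʰR = A ⊗ R` gives `∇ʰRic = A ⊗ Ric` (`hCovLow_ric`). Contracting
again with the parallel inverse metric gives `∇ʰr = r A` (`delta_scal_of_recurrent`). Since `G` is
built from `g` and the identity, `∇ʰG = 0` (`hCovMix_gTensor`), so `C`, which is `R` minus a
multiple of `rG`, inherits the factor `A` (`hCovMix_concirc_of_recurrent`).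

For (c), differentiating the recurrence once more yields `∇ʰ∇ʰR = (∇ʰA) ⊗ R + A ⊗ ∇ʰR = (∇ʰA + A ⊗
A) ⊗ R`, and likewise for `Ric`, so `α = ∇ʰA + A ⊗ A` serves for both.

The longer task is to show that this `α`, given by components in each chart, is a scalar 2-form on
the manifold. Homogeneity is a count of degrees: `g` and the horizontal coefficients have degree 0,
the nonlinear connection degree 1, the spray degree 2. Independence of the chart follows from the
transformation rules, derived in turn for the metric, the spray, the nonlinear connection, `δ_j` and
the horizontal coefficients. The second derivatives of the coordinate change that appear on the way
cancel in `∇ʰA` (`IsTransition.hCovLow_one`). So `α` can be defined at each point through the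
preferred chart there and agrees with its components in every chart (`covAddSqFun_chart`). -/

noncomputable section

namespace Finsler

variable {n : ℕ}

/-! ## Horizontal differentiation -/

/-- The horizontal lift `δ_j = ∂/∂xʲ - Nᵏ_j ∂/∂yᵏ` of the `j`-th coordinate vector. -/
def horVec (F : Coord n × Coord n → ℝ) (j : Fin n) (z : Coord n × Coord n) : Coord n × Coord n :=
  (coordVec j, 0) - ∑ k, nonlin F k j z • ((0, coordVec k) : Coord n × Coord n)

/-- At a fixed point `δ_j` is one directional derivative, so the rules for sums, products and
constants come directly from those of `fderiv`. -/
theorem delta_eq_fderiv (F : Coord n × Coord n → ℝ) (j : Fin n) (f : Coord n × Coord n → ℝ)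
    (z : Coord n × Coord n) : delta F j f z = fderiv ℝ f z (horVec F j z) := by
  simp only [delta, dX, dY, horVec, map_sub, map_sum, map_smul, smul_eq_mul]

section Delta

variable {F f g : Coord n × Coord n → ℝ} {j : Fin n} {z : Coord n × Coord n}

theorem delta_congr (h : f =ᶠ[nhds z] g) : delta F j f z = delta F j g z := by
  rw [delta_eq_fderiv, delta_eq_fderiv, h.fderiv_eq]

theorem delta_congr_of_isOpen {U : Set (Coord n × Coord n)} (hU : IsOpen U) (hz : z ∈ U)
    (h : ∀ w ∈ U, f w = g w) : delta F j f z = delta F j g z :=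
  delta_congr (Filter.eventuallyEq_of_mem (hU.mem_nhds hz) h)

theorem delta_const (c : ℝ) : delta F j (fun _ => c) z = 0 := by
  simp [delta_eq_fderiv]

theorem delta_sub (hf : DifferentiableAt ℝ f z) (hg : DifferentiableAt ℝ g z) :
    delta F j (fun w => f w - g w) z = delta F j f z - delta F j g z := by
  simp only [delta_eq_fderiv]
  rw [fderiv_fun_sub hf hg]; rfl

theorem delta_mul (hf : DifferentiableAt ℝ f z) (hg : DifferentiableAt ℝ g z) :
    delta F j (fun w => f w * g w) z = delta F j f z * g z + f z * delta F j g z := by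
  simp only [delta_eq_fderiv]
  rw [fderiv_fun_mul hf hg]
  simp only [add_apply, smul_apply, smul_eq_mul]
  ring

theorem delta_sum {ι : Type*} (s : Finset ι) {f : ι → Coord n × Coord n → ℝ}
    (hf : ∀ i ∈ s, DifferentiableAt ℝ (f i) z) :
    delta F j (fun w => ∑ i ∈ s, f i w) z = ∑ i ∈ s, delta F j (f i) z := by
  simp only [delta_eq_fderiv]
  rw [fderiv_fun_sum hf]
  simp

theorem delta_mul_const (hf : DifferentiableAt ℝ f z) (c : ℝ) :
    delta F j (fun w => f w * c) z = delta F j f z * c := by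
  rw [delta_mul hf (differentiableAt_const c), delta_const]; ring

end Delta

/-! ## Smoothness of the components -/

section Smooth

variable {U : Set (Coord n × Coord n)}

theorem contDiffOn_dX (hU : IsOpen U) {f : Coord n × Coord n → ℝ} (hf : ContDiffOn ℝ ∞ f U)
    (i : Fin n) : ContDiffOn ℝ ∞ (dX i f) U :=
  (hf.fderiv_of_isOpen hU (by norm_num)).clm_apply contDiffOn_const

theorem contDiffOn_dY (hU : IsOpen U) {f : Coord n × Coord n → ℝ} (hf : ContDiffOn ℝ ∞ f U)
    (i : Fin n) : ContDiffOn ℝ ∞ (dY i f) U :=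
  (hf.fderiv_of_isOpen hU (by norm_num)).clm_apply contDiffOn_const

theorem contDiffOn_det {ι : Type*} [Fintype ι] [DecidableEq ι]
    {m : Coord n × Coord n → Matrix ι ι ℝ}
    (h : ∀ a b, ContDiffOn ℝ ∞ (fun z => m z a b) U) :
    ContDiffOn ℝ ∞ (fun z => (m z).det) U := by
  simp only [Matrix.det_apply]
  refine ContDiffOn.sum fun σ _ => ?_
  exact (contDiffOn_prod fun i _ => h _ _).const_smul _

/-- Cramer's rule: the entries are determinants divided by a nonvanishing determinant. Each adjugate
entry is the determinant of the matrix with one row replaced by a constant unit vector. -/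
theorem contDiffOn_matrix_inv {ι : Type*} [Fintype ι] [DecidableEq ι]
    {m : Coord n × Coord n → Matrix ι ι ℝ}
    (h : ∀ a b, ContDiffOn ℝ ∞ (fun z => m z a b) U) (hdet : ∀ z ∈ U, (m z).det ≠ 0) (a b : ι) :
    ContDiffOn ℝ ∞ (fun z => (m z)⁻¹ a b) U := by
  simp only [Matrix.inv_def, Ring.inverse_eq_inv', Matrix.smul_apply, smul_eq_mul,
    Matrix.adjugate_apply]
  refine ((contDiffOn_det h).inv hdet).mul (contDiffOn_det fun c d => ?_)
  by_cases hc : c = b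
  · subst hc
    simp only [Matrix.updateRow_self]
    exact contDiffOn_const
  · simp only [Matrix.updateRow_ne hc]
    exact h c d

/-- A smooth function on an open set of the coordinate space of the tangent bundle whose Finsler
metric is nondegenerate. -/
structure IsRegular (F : Coord n × Coord n → ℝ) (U : Set (Coord n × Coord n)) : Prop where
  isOpen : IsOpen U
  smooth : ContDiffOn ℝ ∞ F U
  det_ne : ∀ z ∈ U, (Matrix.of fun a b => metric F a b z).det ≠ 0

namespace IsRegular

variable {F : Coord n × Coord n → ℝ} (h : IsRegular F U)
include h

theorem sq : ContDiffOn ℝ ∞ (fun w => F w ^ 2) U := h.smooth.pow 2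

theorem metric (i j : Fin n) : ContDiffOn ℝ ∞ (metric F i j) U :=
  contDiffOn_const.mul (contDiffOn_dY h.isOpen (contDiffOn_dY h.isOpen h.sq j) i)

theorem metricInv (i j : Fin n) : ContDiffOn ℝ ∞ (metricInv F i j) U :=
  contDiffOn_matrix_inv (fun a b => h.metric a b) h.det_ne i j

theorem cartanLow (i j k : Fin n) : ContDiffOn ℝ ∞ (cartanLow F i j k) U :=
  contDiffOn_const.mul (contDiffOn_dY h.isOpen (h.metric i j) k)

theorem vertCoeff (i j k : Fin n) : ContDiffOn ℝ ∞ (vertCoeff F i j k) U :=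
  ContDiffOn.sum fun l _ => (h.metricInv i l).mul (h.cartanLow l j k)

theorem spray (i : Fin n) : ContDiffOn ℝ ∞ (spray F i) U := by
  refine contDiffOn_const.mul (ContDiffOn.sum fun l _ => (h.metricInv i l).mul
    (ContDiffOn.sub (ContDiffOn.sum fun k _ => ContDiffOn.mul ?_ ?_) ?_))
  · exact ContDiff.contDiffOn (by fun_prop)
  · exact contDiffOn_dX h.isOpen (contDiffOn_dY h.isOpen h.sq l) k
  · exact contDiffOn_dX h.isOpen h.sq l

theorem nonlin (i j : Fin n) : ContDiffOn ℝ ∞ (nonlin F i j) U :=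
  contDiffOn_dY h.isOpen (h.spray i) j

theorem delta {f : Coord n × Coord n → ℝ} (hf : ContDiffOn ℝ ∞ f U) (j : Fin n) :
    ContDiffOn ℝ ∞ (delta F j f) U :=
  (contDiffOn_dX h.isOpen hf j).sub
    (ContDiffOn.sum fun k _ => (h.nonlin k j).mul (contDiffOn_dY h.isOpen hf k))

theorem horCoeff (i j k : Fin n) : ContDiffOn ℝ ∞ (horCoeff F i j k) U :=
  contDiffOn_const.mul (ContDiffOn.sum fun l _ => (h.metricInv i l).mul
    (((h.delta (h.metric l k) j).add (h.delta (h.metric j l) k)).sub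
      (h.delta (h.metric j k) l)))

theorem nonlinCurv (i j k : Fin n) : ContDiffOn ℝ ∞ (nonlinCurv F i j k) U :=
  (h.delta (h.nonlin i j) k).sub (h.delta (h.nonlin i k) j)

theorem hCurv (i : Fin n) (J : Fin 3 → Fin n) : ContDiffOn ℝ ∞ (hCurv F i J) U :=
  (((h.delta (h.horCoeff _ _ _) _).sub (h.delta (h.horCoeff _ _ _) _)).add
    (ContDiffOn.sum fun _ _ => ((h.horCoeff _ _ _).mul (h.horCoeff _ _ _)).sub
      ((h.horCoeff _ _ _).mul (h.horCoeff _ _ _)))).add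
    (ContDiffOn.sum fun _ _ => (h.vertCoeff _ _ _).mul (h.nonlinCurv _ _ _))

theorem ric (J : Fin 2 → Fin n) : ContDiffOn ℝ ∞ (ric F J) U :=
  ContDiffOn.sum fun _ _ => h.hCurv _ _

theorem scal : ContDiffOn ℝ ∞ (scal F) U :=
  ContDiffOn.sum fun _ _ => ContDiffOn.sum fun _ _ => (h.metricInv _ _).mul (h.ric _)

theorem gTensor (i : Fin n) (J : Fin 3 → Fin n) : ContDiffOn ℝ ∞ (gTensor F i J) U :=
  ((h.metric _ _).mul contDiffOn_const).sub ((h.metric _ _).mul contDiffOn_const)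

theorem hCovLow {s : ℕ} {T : LowComp n s} (hT : ∀ J, ContDiffOn ℝ ∞ (T J) U)
    (J : Fin (s + 1) → Fin n) : ContDiffOn ℝ ∞ (hCovLow F T J) U :=
  (h.delta (hT _) _).sub (ContDiffOn.sum fun _ _ => ContDiffOn.sum fun _ _ =>
    (h.horCoeff _ _ _).mul (hT _))

theorem differentiableAt {f : Coord n × Coord n → ℝ} (hf : ContDiffOn ℝ ∞ f U)
    {z : Coord n × Coord n} (hz : z ∈ U) : DifferentiableAt ℝ f z :=
  (hf.contDiffAt (h.isOpen.mem_nhds hz)).differentiableAt (by simp)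

end IsRegular

theorem dY_dY_comm (hU : IsOpen U) {f : Coord n × Coord n → ℝ} (hf : ContDiffOn ℝ ∞ f U)
    {z : Coord n × Coord n} (hz : z ∈ U) (i j : Fin n) :
    dY i (dY j f) z = dY j (dY i f) z := by
  have hc : ContDiffAt ℝ ∞ f z := hf.contDiffAt (hU.mem_nhds hz)
  have hs : IsSymmSndFDerivAt ℝ f z := hc.isSymmSndFDerivAt (by
    rw [minSmoothness_of_isRCLikeNormedField]
    exact WithTop.coe_le_coe.2 (le_top : (2 : ℕ∞) ≤ ⊤))
  have hd : DifferentiableAt ℝ (fderiv ℝ f) z :=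
    (hc.fderiv_right (m := ∞) (by norm_num)).differentiableAt (by simp)
  have key : ∀ v w : Coord n × Coord n,
      fderiv ℝ (fun p => fderiv ℝ f p v) z w = fderiv ℝ (fderiv ℝ f) z w v := by
    intro v w
    rw [fderiv_clm_apply hd (differentiableAt_const v)]
    simp
  change fderiv ℝ (fun p => fderiv ℝ f p _) z _ = fderiv ℝ (fun p => fderiv ℝ f p _) z _
  rw [key, key]
  exact hs _ _

theorem IsRegular.metric_symm {F : Coord n × Coord n → ℝ} (h : IsRegular F U)
    {z : Coord n × Coord n} (hz : z ∈ U) (i j : Fin n) :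
    Finsler.metric F i j z = Finsler.metric F j i z := by
  simp only [Finsler.metric]
  rw [dY_dY_comm h.isOpen h.sq hz]

theorem IsRegular.sum_metric_mul_metricInv {F : Coord n × Coord n → ℝ} (h : IsRegular F U)
    {z : Coord n × Coord n} (hz : z ∈ U) (i j : Fin n) :
    ∑ l, Finsler.metric F i l z * Finsler.metricInv F l j z = if i = j then 1 else 0 := by
  have := congrFun (congrFun (Matrix.mul_nonsing_inv (Matrix.of fun a b => Finsler.metric F a b z)
    (isUnit_iff_ne_zero.2 (h.det_ne z hz))) i) j
  rwa [Matrix.mul_apply, Matrix.one_apply] at this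

end Smooth

/-! ## Algebra of the horizontal covariant derivative -/

section Covariant

variable {F : Coord n × Coord n → ℝ} {U : Set (Coord n × Coord n)} {z : Coord n × Coord n}

theorem update_vec3_zero {α : Type*} (a b c m : α) :
    Function.update ![a, b, c] 0 m = ![m, b, c] := by
  funext i; fin_cases i <;> rfl

theorem update_vec3_one {α : Type*} (a b c m : α) :
    Function.update ![a, b, c] 1 m = ![a, m, c] := by
  funext i; fin_cases i <;> rfl

theorem update_vec3_two {α : Type*} (a b c m : α) :
    Function.update ![a, b, c] 2 m = ![a, b, m] := by
  funext i; fin_cases i <;> rfl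

theorem update_vec2_zero {α : Type*} (a b m : α) : Function.update ![a, b] 0 m = ![m, b] := by
  funext i; fin_cases i <;> rfl

theorem update_vec2_one {α : Type*} (a b m : α) : Function.update ![a, b] 1 m = ![a, m] := by
  funext i; fin_cases i <;> rfl

theorem update_vec1_zero {α : Type*} (a m : α) : Function.update ![a] 0 m = ![m] := by
  funext i; fin_cases i; rfl

theorem eq_vec3 {α : Type*} (J : Fin 3 → α) : J = ![J 0, J 1, J 2] := by
  funext i; fin_cases i <;> rfl

theorem eq_vec2 {α : Type*} (J : Fin 2 → α) : J = ![J 0, J 1] := by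
  funext i; fin_cases i <;> rfl

theorem hCovMix_three (T : MixComp n 3) (i l a b c : Fin n) :
    hCovMix F T i (Fin.cons l ![a, b, c]) z = delta F l (T i ![a, b, c]) z
      + ∑ m, horCoeff F i m l z * T m ![a, b, c] z
      - (∑ m, horCoeff F m a l z * T i ![m, b, c] z + ∑ m, horCoeff F m b l z * T i ![a, m, c] z
        + ∑ m, horCoeff F m c l z * T i ![a, b, m] z) := by
  simp [hCovMix, Fin.sum_univ_three, update_vec3_zero, update_vec3_one,
    update_vec3_two]

theorem hCovLow_two (T : LowComp n 2) (l a b : Fin n) :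
    hCovLow F T (Fin.cons l ![a, b]) z = delta F l (T ![a, b]) z
      - (∑ m, horCoeff F m a l z * T ![m, b] z + ∑ m, horCoeff F m b l z * T ![a, m] z) := by
  simp [hCovLow, Fin.sum_univ_two, update_vec2_zero, update_vec2_one]

theorem hCovLow_one (T : LowComp n 1) (l a : Fin n) :
    hCovLow F T ![l, a] z = delta F l (T ![a]) z - ∑ m, horCoeff F m a l z * T ![m] z := by
  have : Fin.tail ![l, a] = ![a] := by funext i; fin_cases i; rfl
  simp [hCovLow, this, update_vec1_zero]

/-- The horizontal covariant derivative commutes with the contraction that defines `Ric`. -/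
theorem hCovLow_ric (h : IsRegular F U) (hz : z ∈ U) (l a b : Fin n) :
    hCovLow F (ric F) (Fin.cons l ![a, b]) z
      = ∑ k, hCovMix F (hCurv F) k (Fin.cons l ![a, k, b]) z := by
  have hd : delta F l (ric F ![a, b]) z = ∑ k, delta F l (hCurv F k ![a, k, b]) z :=
    delta_sum _ fun k _ => h.differentiableAt (h.hCurv _ _) hz
  simp only [hCovMix_three, hCovLow_two, hd, Finset.sum_sub_distrib, Finset.sum_add_distrib]
  have h1 : ∑ m, horCoeff F m a l z * ric F ![m, b] z
      = ∑ k, ∑ m, horCoeff F m a l z * hCurv F k ![m, k, b] z := by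
    rw [Finset.sum_comm]
    exact Finset.sum_congr rfl fun m _ => Finset.mul_sum _ _ _
  have h2 : ∑ m, horCoeff F m b l z * ric F ![a, m] z
      = ∑ k, ∑ m, horCoeff F m b l z * hCurv F k ![a, k, m] z := by
    rw [Finset.sum_comm]
    exact Finset.sum_congr rfl fun m _ => Finset.mul_sum _ _ _
  -- The two contracted indices, one upper and one lower, contribute the same double sum with
  -- opposite signs.
  have h3 : ∑ k, ∑ m, horCoeff F k m l z * hCurv F m ![a, k, b] z
      = ∑ k, ∑ m, horCoeff F m k l z * hCurv F k ![a, m, b] z := Finset.sum_comm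
  rw [h1, h2, h3]
  ring

/-- If `∇ʰT = A ⊗ T`, then `∇ʰ∇ʰT = (∇ʰA + A ⊗ A) ⊗ T`. -/
theorem hCovMix_hCovMix_of_recurrent (h : IsRegular F U) {s : ℕ} {T : MixComp n s}
    {A : LowComp n 1} (hT : ∀ i J, ContDiffOn ℝ ∞ (T i J) U)
    (hA : ∀ J, ContDiffOn ℝ ∞ (A J) U)
    (hrec : ∀ w ∈ U, ∀ i l J, hCovMix F T i (Fin.cons l J) w = A ![l] w * T i J w)
    (hz : z ∈ U) (i k l : Fin n) (J : Fin s → Fin n) :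
    hCovMix F (hCovMix F T) i (Fin.cons k (Fin.cons l J)) z
      = (hCovLow F A ![k, l] z + A ![k] z * A ![l] z) * T i J z := by
  -- The recurrence holds on all of the open set, so both sides may be differentiated.
  have hd : delta F k (hCovMix F T i (Fin.cons l J)) z
      = delta F k (A ![l]) z * T i J z + A ![l] z * delta F k (T i J) z := by
    rw [← delta_mul (h.differentiableAt (hA _) hz) (h.differentiableAt (hT _ _) hz)]
    exact delta_congr_of_isOpen h.isOpen hz fun w hw => hrec w hw _ _ _
  have hk := hrec z hz i k J
  simp only [hCovMix, Fin.cons_zero, Fin.tail_cons] at hk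
  rw [hCovMix, hCovLow_one]
  simp only [Fin.cons_zero, Fin.tail_cons, Fin.sum_univ_succ (n := s), Fin.cons_succ,
    Fin.update_cons_zero, ← Fin.cons_update, hrec z hz, hd]
  have e1 : ∑ m, horCoeff F i m k z * (A ![l] z * T m J z)
      = A ![l] z * ∑ m, horCoeff F i m k z * T m J z := by
    rw [Finset.mul_sum]; exact Finset.sum_congr rfl fun m _ => by ring
  have e2 : ∑ a : Fin s, ∑ m, horCoeff F m (J a) k z * (A ![l] z * T i (Function.update J a m) z)
      = A ![l] z * ∑ a : Fin s, ∑ m, horCoeff F m (J a) k z * T i (Function.update J a m) z := by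
    simp only [Finset.mul_sum]
    exact Finset.sum_congr rfl fun a _ => Finset.sum_congr rfl fun m _ => by ring
  -- The connection term of the index `l` created by the first derivative is what completes `δ_k
  -- A_l` to `∇_k A_l`.
  have e3 : ∑ m, horCoeff F m l k z * (A ![m] z * T i J z)
      = (∑ m, horCoeff F m l k z * A ![m] z) * T i J z := by
    rw [Finset.sum_mul]; exact Finset.sum_congr rfl fun m _ => by ring
  rw [e1, e2, e3]
  linear_combination A ![l] z * hk

/-- If `∇ʰT = A ⊗ T`, then `∇ʰ∇ʰT = (∇ʰA + A ⊗ A) ⊗ T`. -/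
theorem hCovLow_hCovLow_of_recurrent (h : IsRegular F U) {s : ℕ} {T : LowComp n s}
    {A : LowComp n 1} (hT : ∀ J, ContDiffOn ℝ ∞ (T J) U)
    (hA : ∀ J, ContDiffOn ℝ ∞ (A J) U)
    (hrec : ∀ w ∈ U, ∀ l J, hCovLow F T (Fin.cons l J) w = A ![l] w * T J w)
    (hz : z ∈ U) (k l : Fin n) (J : Fin s → Fin n) :
    hCovLow F (hCovLow F T) (Fin.cons k (Fin.cons l J)) z
      = (hCovLow F A ![k, l] z + A ![k] z * A ![l] z) * T J z := by
  have hd : delta F k (hCovLow F T (Fin.cons l J)) z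
      = delta F k (A ![l]) z * T J z + A ![l] z * delta F k (T J) z := by
    rw [← delta_mul (h.differentiableAt (hA _) hz) (h.differentiableAt (hT _) hz)]
    exact delta_congr_of_isOpen h.isOpen hz fun w hw => hrec w hw _ _
  have hk := hrec z hz k J
  simp only [hCovLow, Fin.cons_zero, Fin.tail_cons] at hk
  rw [hCovLow_one, hCovLow]
  simp only [Fin.cons_zero, Fin.tail_cons, Fin.sum_univ_succ (n := s), Fin.cons_succ,
    Fin.update_cons_zero, ← Fin.cons_update, hrec z hz, hd]
  have e2 : ∑ a : Fin s, ∑ m, horCoeff F m (J a) k z * (A ![l] z * T (Function.update J a m) z)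
      = A ![l] z * ∑ a : Fin s, ∑ m, horCoeff F m (J a) k z * T (Function.update J a m) z := by
    simp only [Finset.mul_sum]
    exact Finset.sum_congr rfl fun a _ => Finset.sum_congr rfl fun m _ => by ring
  have e3 : ∑ m, horCoeff F m l k z * (A ![m] z * T J z)
      = (∑ m, horCoeff F m l k z * A ![m] z) * T J z := by
    rw [Finset.sum_mul]; exact Finset.sum_congr rfl fun m _ => by ring
  rw [e2, e3]
  linear_combination A ![l] z * hk

/-! ## Metric compatibility -/

/-- Lowering the upper index of the horizontal coefficients gives the Christoffel symbols of the
first kind. -/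
theorem sum_metric_mul_horCoeff (h : IsRegular F U) (hz : z ∈ U) (a i l : Fin n) :
    ∑ m, metric F a m z * horCoeff F m i l z
      = (1 / 2) * (delta F i (metric F a l) z + delta F l (metric F i a) z
          - delta F a (metric F i l) z) := by
  simp only [horCoeff]
  set S : Fin n → ℝ := fun p => delta F i (metric F p l) z + delta F l (metric F i p) z
          - delta F p (metric F i l) z with hS
  calc ∑ m, metric F a m z * (1 / 2 * ∑ p, metricInv F m p z * S p)
      = 1 / 2 * ∑ p, (∑ m, metric F a m z * metricInv F m p z) * S p := by
        simp only [Finset.mul_sum, Finset.sum_mul]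
        rw [Finset.sum_comm]
        exact Finset.sum_congr rfl fun p _ => Finset.sum_congr rfl fun m _ => by ring
    _ = 1 / 2 * S a := by simp [h.sum_metric_mul_metricInv hz]

theorem delta_metric_symm (h : IsRegular F U) (hz : z ∈ U) (l i j : Fin n) :
    delta F l (metric F i j) z = delta F l (metric F j i) z :=
  delta_congr_of_isOpen h.isOpen hz fun _ hw => h.metric_symm hw i j

/-- The Cartan connection is horizontally metric: `∇ʰg = 0`. -/
theorem delta_metric (h : IsRegular F U) (hz : z ∈ U) (l i j : Fin n) :
    delta F l (metric F i j) z
      = ∑ m, horCoeff F m i l z * metric F m j z + ∑ m, horCoeff F m j l z * metric F i m z := by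
  have h1 : ∑ m, horCoeff F m i l z * metric F m j z
      = ∑ m, metric F j m z * horCoeff F m i l z :=
    Finset.sum_congr rfl fun m _ => by rw [h.metric_symm hz m j]; ring
  have h2 : ∑ m, horCoeff F m j l z * metric F i m z
      = ∑ m, metric F i m z * horCoeff F m j l z :=
    Finset.sum_congr rfl fun m _ => by ring
  -- In the sum of the two Christoffel symbols of the first kind, all but the two halves of `δ_l
  -- g_{ij}` cancel by symmetry of `g`.
  rw [h1, h2, sum_metric_mul_horCoeff h hz, sum_metric_mul_horCoeff h hz,
    delta_metric_symm h hz i j l, delta_metric_symm h hz j i l, delta_metric_symm h hz l j i]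
  rw [delta_metric_symm h hz j l i]
  ring

theorem gTensor_apply (i a b c : Fin n) (z : Coord n × Coord n) :
    gTensor F i ![a, b, c] z
      = metric F a c z * (if i = b then 1 else 0) - metric F b c z * (if i = a then 1 else 0) :=
  rfl

/-- Both ingredients of `G` are parallel: `g` by metric compatibility, and the Kronecker delta
because its upper and lower connection terms cancel. -/
theorem hCovMix_gTensor (h : IsRegular F U) (hz : z ∈ U) (i l a b c : Fin n) :
    hCovMix F (gTensor F) i (Fin.cons l ![a, b, c]) z = 0 := by
  have hd : delta F l (gTensor F i ![a, b, c]) z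
      = delta F l (metric F a c) z * (if i = b then 1 else 0)
        - delta F l (metric F b c) z * (if i = a then 1 else 0) := by
    have h1 := h.differentiableAt (h.metric a c) hz
    have h2 := h.differentiableAt (h.metric b c) hz
    rw [← delta_mul_const h1, ← delta_mul_const h2,
      ← delta_sub (h1.mul_const _) (h2.mul_const _)]
    rfl
  rw [hCovMix_three, hd, delta_metric h hz, delta_metric h hz]
  simp only [gTensor_apply, mul_sub, Finset.sum_sub_distrib, mul_ite, mul_one, mul_zero, Finset.sum_ite_eq,
    Finset.sum_ite_eq', Finset.mem_univ, if_true]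
  split_ifs <;> (try simp) <;> ring

/-- This is `∇ʰg⁻¹ = 0` in matrix form. Differentiating `g g⁻¹ = 1` gives `dg⁻¹ = -g⁻¹ (dg) g⁻¹`,
and `dg` is known from `delta_metric`. -/
theorem delta_metricInv (h : IsRegular F U) (hz : z ∈ U) (l : Fin n) :
    (Matrix.of fun i j => delta F l (metricInv F i j) z)
      = -((Matrix.of fun i m => horCoeff F i m l z) * (Matrix.of fun i j => metricInv F i j z)
        + (Matrix.of fun i j => metricInv F i j z)
          * (Matrix.of fun i m => horCoeff F i m l z).transpose) := by
  set g : Matrix (Fin n) (Fin n) ℝ := Matrix.of fun i j => metric F i j z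
  set H : Matrix (Fin n) (Fin n) ℝ := Matrix.of fun i m => horCoeff F i m l z
  set I : Matrix (Fin n) (Fin n) ℝ := Matrix.of fun i j => metricInv F i j z
  set dg : Matrix (Fin n) (Fin n) ℝ := Matrix.of fun i j => delta F l (metric F i j) z
  set dI : Matrix (Fin n) (Fin n) ℝ := Matrix.of fun i j => delta F l (metricInv F i j) z
  have hgI : g * I = 1 := by
    ext i j
    rw [Matrix.mul_apply, Matrix.one_apply]
    exact h.sum_metric_mul_metricInv hz i j
  have hIg : I * g = 1 := mul_eq_one_comm.1 hgI
  have hdg : dg = H.transpose * g + g * H := by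
    ext i j
    simp only [dg, g, H, Matrix.of_apply, Matrix.add_apply, Matrix.mul_apply,
      Matrix.transpose_apply, delta_metric h hz]
    congr 1
    exact Finset.sum_congr rfl fun m _ => mul_comm _ _
  have hprod : dg * I + g * dI = 0 := by
    ext i j
    have e1 : delta F l (fun w => ∑ m, metric F i m w * metricInv F m j w) z = 0 := by
      rw [delta_congr_of_isOpen h.isOpen hz
        (fun w hw => h.sum_metric_mul_metricInv hw i j), delta_const]
    rw [delta_sum _ fun m _ => (h.differentiableAt (h.metric i m) hz).fun_mul
      (h.differentiableAt (h.metricInv m j) hz)] at e1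
    simp only [Matrix.add_apply, Matrix.mul_apply, Matrix.zero_apply, ← Finset.sum_add_distrib]
    rw [← e1]
    refine Finset.sum_congr rfl fun m _ => ?_
    rw [delta_mul (h.differentiableAt (h.metric i m) hz)
      (h.differentiableAt (h.metricInv m j) hz)]
    rfl
  have : dI = -(I * dg * I) := by
    calc dI = I * g * dI := by rw [hIg, one_mul]
      _ = I * (dg * I + g * dI) - I * dg * I := by noncomm_ring
      _ = _ := by rw [hprod]; simp
  rw [this, hdg, mul_add, add_mul]
  rw [show I * (g * H) * I = (I * g) * (H * I) by noncomm_ring,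
    show I * (H.transpose * g) * I = I * H.transpose * (g * I) by noncomm_ring, hgI, hIg]
  simp [add_comm]

/-- If `∇ʰRic = A ⊗ Ric`, then `∇ʰr = A r`. -/
theorem delta_scal_of_recurrent (h : IsRegular F U) (hz : z ∈ U) (l : Fin n) {A : ℝ}
    (hrec : ∀ a b, hCovLow F (ric F) (Fin.cons l ![a, b]) z = A * ric F ![a, b] z) :
    delta F l (scal F) z = A * scal F z := by
  set H : Matrix (Fin n) (Fin n) ℝ := Matrix.of fun i m => horCoeff F i m l z with hH
  set I : Matrix (Fin n) (Fin n) ℝ := Matrix.of fun i j => metricInv F i j z with hI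
  set R : Matrix (Fin n) (Fin n) ℝ := Matrix.of fun i j => ric F ![i, j] z with hR
  set dI : Matrix (Fin n) (Fin n) ℝ := Matrix.of fun i j => delta F l (metricInv F i j) z with hdI
  set dR : Matrix (Fin n) (Fin n) ℝ := Matrix.of fun i j => delta F l (ric F ![i, j]) z with hdR
  have hs : scal F z = (I * R.transpose).trace := by
    simp [scal, Matrix.trace, Matrix.mul_apply, hI, hR]
  have hds : delta F l (scal F) z = (dI * R.transpose).trace + (I * dR.transpose).trace := by
    have hm : ∀ i j, DifferentiableAt ℝ (metricInv F i j) z := fun i j =>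
      h.differentiableAt (h.metricInv i j) hz
    have hr : ∀ J, DifferentiableAt ℝ (ric F J) z := fun J => h.differentiableAt (h.ric J) hz
    have : delta F l (scal F) z = ∑ i, ∑ j,
        (delta F l (metricInv F i j) z * ric F ![i, j] z
          + metricInv F i j z * delta F l (ric F ![i, j]) z) := by
      unfold scal
      rw [delta_sum _ fun i _ => DifferentiableAt.fun_sum fun j _ => (hm i j).fun_mul (hr _)]
      refine Finset.sum_congr rfl fun i _ => ?_
      rw [delta_sum _ fun j _ => (hm i j).fun_mul (hr _)]
      exact Finset.sum_congr rfl fun j _ => delta_mul (hm i j) (hr _)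
    simp [this, Matrix.trace, Matrix.mul_apply, hI, hR, hdI, hdR, Finset.sum_add_distrib]
  -- The recurrence solved for the plain horizontal derivative of `Ric`.
  have hdR' : dR = A • R + H.transpose * R + R * H := by
    ext a b
    have := hrec a b
    rw [hCovLow_two] at this
    simp only [hdR, hR, hH, Matrix.of_apply, Matrix.add_apply, Matrix.smul_apply, smul_eq_mul,
      Matrix.mul_apply, Matrix.transpose_apply]
    rw [show ∑ j, ric F ![a, j] z * horCoeff F j b l z
      = ∑ m, horCoeff F m b l z * ric F ![a, m] z from
        Finset.sum_congr rfl fun m _ => mul_comm _ _]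
    linarith
  rw [hds, hs, hdR', hdI, delta_metricInv h hz]
  simp only [Matrix.transpose_add, Matrix.transpose_mul, Matrix.transpose_smul,
    Matrix.transpose_transpose, mul_add, Matrix.mul_smul, Matrix.trace_add, Matrix.trace_smul,
    neg_mul, add_mul, Matrix.trace_neg, smul_eq_mul]
  rw [← hH, ← hI]
  -- Cyclicity of the trace makes one pair of connection terms from `dI` and `dR` cancel; the other
  -- pair cancels by associativity alone.
  have e1 : (I * (R.transpose * H)).trace = (H * I * R.transpose).trace := by
    rw [← mul_assoc, Matrix.trace_mul_comm, ← mul_assoc]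
  rw [e1, ← mul_assoc]
  ring

/-- If `∇ʰR = A ⊗ R` and `∇ʰr = A r`, then `∇ʰC = A ⊗ C`. -/
theorem hCovMix_concirc_of_recurrent (h : IsRegular F U) (hz : z ∈ U) (l : Fin n) {A : ℝ}
    (hrec : ∀ i J, hCovMix F (hCurv F) i (Fin.cons l J) z = A * hCurv F i J z)
    (hs : delta F l (scal F) z = A * scal F z) (i : Fin n) (J : Fin 3 → Fin n) :
    hCovMix F (concirc F) i (Fin.cons l J) z = A * concirc F i J z := by
  rw [eq_vec3 J]
  generalize J 0 = a, J 1 = b, J 2 = c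
  -- Only the constant `κ⁻¹` enters, so no nonvanishing of `κ` is needed.
  set κ : ℝ := (n : ℝ) * ((n : ℝ) - 1)
  have hR := hrec i ![a, b, c]
  have hG := hCovMix_gTensor h hz i l a b c
  rw [hCovMix_three] at hR hG ⊢
  have hd : delta F l (concirc F i ![a, b, c]) z = delta F l (hCurv F i ![a, b, c]) z
      - (A * scal F z / κ * gTensor F i ![a, b, c] z
        + scal F z / κ * delta F l (gTensor F i ![a, b, c]) z) := by
    have d1 := h.differentiableAt (h.hCurv i ![a, b, c]) hz
    have d2 := h.differentiableAt h.scal hz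
    have d3 := h.differentiableAt (h.gTensor i ![a, b, c]) hz
    have e : delta F l (fun w => scal F w / κ) z = A * scal F z / κ := by
      simp only [div_eq_mul_inv]
      rw [delta_mul_const d2, hs]
    have d4 : DifferentiableAt ℝ (fun w => scal F w / κ) z := by
      simpa only [div_eq_mul_inv] using d2.mul_const κ⁻¹
    rw [← e, ← delta_mul d4 d3, ← delta_sub d1 (d4.fun_mul d3)]
    rfl
  have key : ∀ (u : Fin n → ℝ) (i' : Fin n → Fin n) (J' : Fin n → Fin 3 → Fin n),
      ∑ m, u m * concirc F (i' m) (J' m) z = ∑ m, u m * hCurv F (i' m) (J' m) z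
        - scal F z / κ * ∑ m, u m * gTensor F (i' m) (J' m) z := by
    intro u i' J'
    rw [Finset.mul_sum, ← Finset.sum_sub_distrib]
    exact Finset.sum_congr rfl fun m _ => by simp only [concirc, κ]; ring
  rw [hd, key _ (fun m => m) (fun _ => ![a, b, c]), key _ (fun _ => i) (fun m => ![m, b, c]),
    key _ (fun _ => i) (fun m => ![a, m, c]), key _ (fun _ => i) (fun m => ![a, b, m])]
  have hc : concirc F i ![a, b, c] z
      = hCurv F i ![a, b, c] z - scal F z / κ * gTensor F i ![a, b, c] z := rfl
  rw [hc]
  linear_combination hR - scal F z / κ * hG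

end Covariant

/-! ## Homogeneity -/

section Homogeneity

variable {F : Coord n × Coord n → ℝ} {U : Set (Coord n × Coord n)} {z : Coord n × Coord n}
  {c : ℝ}

/-- Chain rule for the fibre dilation by a fixed `c`. The factor `c` on the vertical part `v` is the
source of the drop of one degree under `∂/∂y`. -/
theorem fderiv_scale (hU : IsOpen U) (hz : z ∈ U) {f : Coord n × Coord n → ℝ} {b : ℝ}
    (hd : DifferentiableAt ℝ f (z.1, c • z.2)) (hf : ∀ w ∈ U, f (w.1, c • w.2) = b * f w)
    (hfz : DifferentiableAt ℝ f z) (u v : Coord n) :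
    fderiv ℝ f (z.1, c • z.2) (u, c • v) = b * fderiv ℝ f z (u, v) := by
  have hS : HasFDerivAt (fun w : Coord n × Coord n => (w.1, c • w.2))
      ((ContinuousLinearMap.fst ℝ (Coord n) (Coord n)).prod
        (c • ContinuousLinearMap.snd ℝ (Coord n) (Coord n))) z :=
    hasFDerivAt_fst.prodMk (hasFDerivAt_snd.const_smul c)
  have h1 := HasFDerivAt.comp z hd.hasFDerivAt hS
  have h2 : HasFDerivAt (fun w => b * f w) (b • fderiv ℝ f z) z := hfz.hasFDerivAt.const_mul b
  have h3 : (fun w => b * f w) =ᶠ[nhds z] f ∘ fun w : Coord n × Coord n => (w.1, c • w.2) :=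
    Filter.eventuallyEq_of_mem (hU.mem_nhds hz) fun w hw => (hf w hw).symm
  have h4 := (h1.congr_of_eventuallyEq h3).unique h2
  simpa using congrArg (fun l => l (u, v)) h4

/-- `U` is invariant under the positive dilation of the fibres by `c`, and `F` is positively
homogeneous of degree one under this dilation. -/
structure IsHomogAt (F : Coord n × Coord n → ℝ) (U : Set (Coord n × Coord n)) (c : ℝ) : Prop where
  reg : IsRegular F U
  pos : 0 < c
  mem : ∀ z ∈ U, (z.1, c • z.2) ∈ U
  eq : ∀ z ∈ U, F (z.1, c • z.2) = c * F z

namespace IsHomogAt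

variable (h : IsHomogAt F U c)
include h

theorem dX {f : Coord n × Coord n → ℝ} {b : ℝ} (hs : ContDiffOn ℝ ∞ f U)
    (hf : ∀ w ∈ U, f (w.1, c • w.2) = b * f w) (i : Fin n) :
    ∀ z ∈ U, dX i f (z.1, c • z.2) = b * dX i f z := by
  intro z hz
  simpa [Finsler.dX] using fderiv_scale h.reg.isOpen hz (h.reg.differentiableAt hs (h.mem z hz)) hf
    (h.reg.differentiableAt hs hz) (coordVec i) 0

/-- The factor is written `c * b` because a vertical derivative loses one degree; the surplus `c` is
then cancelled, being positive. -/
theorem dY {f : Coord n × Coord n → ℝ} {b : ℝ} (hs : ContDiffOn ℝ ∞ f U)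
    (hf : ∀ w ∈ U, f (w.1, c • w.2) = c * b * f w) (i : Fin n) :
    ∀ z ∈ U, dY i f (z.1, c • z.2) = b * dY i f z := by
  intro z hz
  have := fderiv_scale h.reg.isOpen hz (h.reg.differentiableAt hs (h.mem z hz)) hf
    (h.reg.differentiableAt hs hz) 0 (coordVec i)
  rw [show ((0, c • coordVec i) : Coord n × Coord n) = c • (0, coordVec i) by simp,
    map_smul, smul_eq_mul, mul_assoc] at this
  exact mul_left_cancel₀ h.pos.ne' this

theorem dY_sq (i : Fin n) : ∀ z ∈ U,
    Finsler.dY i (fun w => F w ^ 2) (z.1, c • z.2) = c * Finsler.dY i (fun w => F w ^ 2) z :=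
  h.dY h.reg.sq (fun w hw => by simp only [h.eq w hw]; ring) i

theorem metric (i j : Fin n) : ∀ z ∈ U, metric F i j (z.1, c • z.2) = metric F i j z := by
  intro z hz
  simp only [Finsler.metric]
  rw [h.dY (b := 1) (contDiffOn_dY h.reg.isOpen h.reg.sq j)
    (fun w hw => by rw [h.dY_sq j w hw]; ring) i z hz, one_mul]

theorem metricInv (i j : Fin n) :
    ∀ z ∈ U, metricInv F i j (z.1, c • z.2) = metricInv F i j z := by
  intro z hz
  simp only [Finsler.metricInv, h.metric _ _ z hz]

theorem spray (i : Fin n) : ∀ z ∈ U, spray F i (z.1, c • z.2) = c * c * spray F i z := by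
  intro z hz
  have e1 := fun l => h.dX (b := c * c) h.reg.sq (fun w hw => by simp only [h.eq w hw]; ring) l z hz
  have e2 := fun k l => h.dX (contDiffOn_dY h.reg.isOpen h.reg.sq l) (h.dY_sq l) k z hz
  simp only [Finsler.spray, h.metricInv _ _ z hz, e1, e2, PiLp.smul_apply, smul_eq_mul]
  simp only [mul_sub, Finset.mul_sum]
  exact Finset.sum_congr rfl fun l _ => congrArg₂ _
    (Finset.sum_congr rfl fun k _ => by ring) (by ring)

theorem nonlin (i j : Fin n) : ∀ z ∈ U, nonlin F i j (z.1, c • z.2) = c * nonlin F i j z :=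
  h.dY (h.reg.spray i) (h.spray i) j

/-- `δ_j` preserves degree 0: the degree 1 of the nonlinear connection compensates for the degree
`-1` of `∂f/∂y`. -/
theorem delta {f : Coord n × Coord n → ℝ} (hs : ContDiffOn ℝ ∞ f U)
    (hf : ∀ w ∈ U, f (w.1, c • w.2) = f w) (j : Fin n) :
    ∀ z ∈ U, delta F j f (z.1, c • z.2) = delta F j f z := by
  intro z hz
  have hc := h.pos.ne'
  simp only [Finsler.delta, h.nonlin _ _ z hz,
    h.dX (b := 1) hs (fun w hw => by rw [hf w hw, one_mul]) _ z hz,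
    h.dY (b := c⁻¹) hs (fun w hw => by rw [hf w hw, mul_inv_cancel₀ hc, one_mul]) _ z hz, one_mul]
  congr 1
  exact Finset.sum_congr rfl fun k _ => by field_simp

theorem horCoeff (i j k : Fin n) :
    ∀ z ∈ U, horCoeff F i j k (z.1, c • z.2) = horCoeff F i j k z := by
  intro z hz
  simp only [Finsler.horCoeff, h.metricInv _ _ z hz,
    h.delta (h.reg.metric _ _) (h.metric _ _) _ z hz]

theorem hCovLow {s : ℕ} {T : LowComp n s} (hT : ∀ J, ContDiffOn ℝ ∞ (T J) U)
    (hf : ∀ J, ∀ w ∈ U, T J (w.1, c • w.2) = T J w) (J : Fin (s + 1) → Fin n) :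
    ∀ z ∈ U, hCovLow F T J (z.1, c • z.2) = hCovLow F T J z := by
  intro z hz
  simp only [Finsler.hCovLow, h.delta (hT _) (hf _) _ z hz, h.horCoeff _ _ _ z hz, hf _ z hz]

end IsHomogAt

end Homogeneity

/-! ## Change of coordinates -/

section Transition

/-- The Jacobian `∂φᵃ/∂xⁱ`. -/
def jac (φ : Coord n → Coord n) (a i : Fin n) (x : Coord n) : ℝ :=
  fderiv ℝ φ x (coordVec i) a

/-- The second derivatives `∂²φᵃ/∂xⁱ∂xʲ`. -/
def hess (φ : Coord n → Coord n) (a i j : Fin n) (x : Coord n) : ℝ :=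
  fderiv ℝ (fderiv ℝ φ) x (coordVec i) (coordVec j) a

/-- The map of the coordinates `(x, y)` induced by a change of the coordinates `x`. -/
def tangentLift (φ : Coord n → Coord n) (z : Coord n × Coord n) : Coord n × Coord n :=
  (φ z.1, fderiv ℝ φ z.1 z.2)

theorem coord_eq_sum (y : Coord n) : y = ∑ k, y k • coordVec k := by
  ext i
  simp [coordVec, Pi.single_apply]

theorem fderiv_eq_sum (f : Coord n × Coord n → ℝ) (z : Coord n × Coord n) (u v : Coord n) :
    fderiv ℝ f z (u, v) = ∑ a, u a * dX a f z + ∑ a, v a * dY a f z := by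
  have h1 : ((u, v) : Coord n × Coord n) = ∑ a, u a • ((coordVec a, 0) : Coord n × Coord n)
      + ∑ a, v a • ((0, coordVec a) : Coord n × Coord n) := by
    have e1 : ∑ a, u a • ((coordVec a, 0) : Coord n × Coord n) = (u, 0) := by
      ext1
      · simp [Prod.fst_sum, ← coord_eq_sum]
      · simp [Prod.snd_sum]
    have e2 : ∑ a, v a • ((0, coordVec a) : Coord n × Coord n) = (0, v) := by
      ext1
      · simp [Prod.fst_sum]
      · simp [Prod.snd_sum, ← coord_eq_sum]
    rw [e1, e2]
    simp
  rw [h1, map_add, map_sum, map_sum]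
  simp only [map_smul, smul_eq_mul, dX, dY]

theorem tangentLift_snd (φ : Coord n → Coord n) (z : Coord n × Coord n) (a : Fin n) :
    (tangentLift φ z).2 a = ∑ k, z.2 k * jac φ a k z.1 := by
  change fderiv ℝ φ z.1 z.2 a = _
  conv_lhs => rw [coord_eq_sum z.2]
  simp [jac]

theorem hess_apply_snd (φ : Coord n → Coord n) (z : Coord n × Coord n) (a i : Fin n) :
    fderiv ℝ (fderiv ℝ φ) z.1 (coordVec i) z.2 a = ∑ k, z.2 k * hess φ a i k z.1 := by
  conv_lhs => rw [coord_eq_sum z.2]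
  simp [hess]

variable {φ : Coord n → Coord n} {V : Set (Coord n)} {F F' : Coord n × Coord n → ℝ}
  {U U' : Set (Coord n × Coord n)} {z : Coord n × Coord n}

/-- `φ` is a smooth change of coordinates that takes `F` to `F'`. -/
structure IsTransition (φ : Coord n → Coord n) (V : Set (Coord n))
    (F : Coord n × Coord n → ℝ) (U : Set (Coord n × Coord n))
    (F' : Coord n × Coord n → ℝ) (U' : Set (Coord n × Coord n)) : Prop where
  isOpen : IsOpen V
  smooth : ContDiffOn ℝ ∞ φ V
  reg : IsRegular F U
  reg' : IsRegular F' U'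
  fst_mem : ∀ z ∈ U, z.1 ∈ V
  lift_mem : ∀ z ∈ U, tangentLift φ z ∈ U'
  eq : ∀ z ∈ U, F z = F' (tangentLift φ z)

namespace IsTransition

variable (h : IsTransition φ V F U F' U')
include h

theorem contDiffOn_fderiv : ContDiffOn ℝ ∞ (fderiv ℝ φ) V :=
  h.smooth.fderiv_of_isOpen h.isOpen (by norm_num)

theorem hess_symm (hz : z ∈ U) (a i j : Fin n) : hess φ a i j z.1 = hess φ a j i z.1 := by
  have hc : ContDiffAt ℝ ∞ φ z.1 := h.smooth.contDiffAt (h.isOpen.mem_nhds (h.fst_mem z hz))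
  have hs : IsSymmSndFDerivAt ℝ φ z.1 := hc.isSymmSndFDerivAt (by
    rw [minSmoothness_of_isRCLikeNormedField]
    exact WithTop.coe_le_coe.2 (le_top : (2 : ℕ∞) ≤ ⊤))
  simp only [hess]
  rw [hs]

theorem hasFDerivAt_fderiv (hz : z ∈ U) :
    HasFDerivAt (fderiv ℝ φ) (fderiv ℝ (fderiv ℝ φ) z.1) z.1 :=
  ((h.contDiffOn_fderiv.contDiffAt (h.isOpen.mem_nhds (h.fst_mem z hz))).differentiableAt
    (by simp)).hasFDerivAt

theorem hasFDerivAt_jac (hz : z ∈ U) (a k : Fin n) :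
    HasFDerivAt (fun w : Coord n × Coord n => jac φ a k w.1)
      ((EuclideanSpace.proj a : Coord n →L[ℝ] ℝ) ∘L
        ((ContinuousLinearMap.apply ℝ (Coord n) (coordVec k)) ∘L
          ((fderiv ℝ (fderiv ℝ φ) z.1) ∘L (ContinuousLinearMap.fst ℝ (Coord n) (Coord n))))) z :=
  (EuclideanSpace.proj a : Coord n →L[ℝ] ℝ).hasFDerivAt.comp z
    ((ContinuousLinearMap.apply ℝ (Coord n) (coordVec k)).hasFDerivAt.comp z
      ((h.hasFDerivAt_fderiv hz).comp z hasFDerivAt_fst))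

theorem differentiableAt_jac (hz : z ∈ U) (a k : Fin n) :
    DifferentiableAt ℝ (fun w : Coord n × Coord n => jac φ a k w.1) z :=
  (h.hasFDerivAt_jac hz a k).differentiableAt

theorem dX_jac (hz : z ∈ U) (a i k : Fin n) :
    dX i (fun w => jac φ a k w.1) z = hess φ a i k z.1 := by
  simp [dX, (h.hasFDerivAt_jac hz a k).fderiv, hess]

theorem dY_jac (hz : z ∈ U) (a i k : Fin n) : dY i (fun w => jac φ a k w.1) z = 0 := by
  simp [dY, (h.hasFDerivAt_jac hz a k).fderiv]

/-- The Jacobian depends on `x` only, so the vertical part of `δ_j` does not see it. -/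
theorem delta_jac (hz : z ∈ U) (a j k : Fin n) :
    delta F j (fun w => jac φ a k w.1) z = hess φ a j k z.1 := by
  simp [delta, h.dX_jac hz, h.dY_jac hz]

/-- The fibre component is `Dφ(x) y`, bilinear in `Dφ` and `y`. Its Leibniz rule produces the second
derivative that makes all later rules inhomogeneous. -/
theorem hasFDerivAt_lift (hz : z ∈ U) : ∃ D : Coord n × Coord n →L[ℝ] Coord n × Coord n,
    HasFDerivAt (tangentLift φ) D z ∧ ∀ u v, D (u, v) = (fderiv ℝ φ z.1 u,
      fderiv ℝ (fderiv ℝ φ) z.1 u z.2 + fderiv ℝ φ z.1 v) := by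
  have h1 : HasFDerivAt φ (fderiv ℝ φ z.1) z.1 :=
    ((h.smooth.contDiffAt (h.isOpen.mem_nhds (h.fst_mem z hz))).differentiableAt
      (by simp)).hasFDerivAt
  have h2 : HasFDerivAt (fun w : Coord n × Coord n => fderiv ℝ φ w.1)
      ((fderiv ℝ (fderiv ℝ φ) z.1) ∘L (ContinuousLinearMap.fst ℝ (Coord n) (Coord n))) z :=
    (h.hasFDerivAt_fderiv hz).comp z hasFDerivAt_fst
  have h3 : HasFDerivAt (fun w : Coord n × Coord n => φ w.1)
      ((fderiv ℝ φ z.1) ∘L (ContinuousLinearMap.fst ℝ (Coord n) (Coord n))) z :=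
    h1.comp z hasFDerivAt_fst
  refine ⟨_, h3.prodMk (h2.clm_apply hasFDerivAt_snd), fun u v => ?_⟩
  simp [add_comm]

variable {f : Coord n × Coord n → ℝ}

theorem differentiableAt_comp (hz : z ∈ U) (hf : ContDiffOn ℝ ∞ f U') :
    DifferentiableAt ℝ (fun w => f (tangentLift φ w)) z := by
  obtain ⟨D, hD, -⟩ := h.hasFDerivAt_lift hz
  exact (h.reg'.differentiableAt hf (h.lift_mem z hz)).comp z hD.differentiableAt

theorem dY_comp (hz : z ∈ U) (hf : ContDiffOn ℝ ∞ f U') (i : Fin n) :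
    dY i (fun w => f (tangentLift φ w)) z
      = ∑ a, jac φ a i z.1 * dY a f (tangentLift φ z) := by
  obtain ⟨D, hD, hD'⟩ := h.hasFDerivAt_lift hz
  have := ((h.reg'.differentiableAt hf (h.lift_mem z hz)).hasFDerivAt.comp z hD).fderiv
  rw [Function.comp_def] at this
  rw [dY, this, ContinuousLinearMap.comp_apply, hD', fderiv_eq_sum]
  simp [jac]

theorem dX_comp (hz : z ∈ U) (hf : ContDiffOn ℝ ∞ f U') (i : Fin n) :
    dX i (fun w => f (tangentLift φ w)) z
      = ∑ a, jac φ a i z.1 * dX a f (tangentLift φ z)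
        + ∑ a, (∑ k, z.2 k * hess φ a i k z.1) * dY a f (tangentLift φ z) := by
  obtain ⟨D, hD, hD'⟩ := h.hasFDerivAt_lift hz
  have := ((h.reg'.differentiableAt hf (h.lift_mem z hz)).hasFDerivAt.comp z hD).fderiv
  rw [Function.comp_def] at this
  rw [dX, this, ContinuousLinearMap.comp_apply, hD', fderiv_eq_sum]
  simp [jac, hess_apply_snd]

omit h in
theorem _root_.Finsler.fderiv_apply_congr (hU : IsOpen U) (hz : z ∈ U)
    {f g : Coord n × Coord n → ℝ} (hfg : ∀ w ∈ U, f w = g w) (v : Coord n × Coord n) :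
    fderiv ℝ f z v = fderiv ℝ g z v := by
  rw [(Filter.eventuallyEq_of_mem (hU.mem_nhds hz) hfg).fderiv_eq]

omit h in
theorem _root_.Finsler.fderiv_sum_mul {ι : Type*} (s : Finset ι)
    {u f : ι → Coord n × Coord n → ℝ} (hu : ∀ i ∈ s, DifferentiableAt ℝ (u i) z)
    (hf : ∀ i ∈ s, DifferentiableAt ℝ (f i) z) (v : Coord n × Coord n) :
    fderiv ℝ (fun w => ∑ i ∈ s, u i w * f i w) z v
      = ∑ i ∈ s, (fderiv ℝ (u i) z v * f i z + u i z * fderiv ℝ (f i) z v) := by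
  rw [fderiv_fun_sum fun i hi => (hu i hi).fun_mul (hf i hi), sum_apply]
  refine Finset.sum_congr rfl fun i hi => ?_
  rw [fderiv_fun_mul (hu i hi) (hf i hi)]
  simp only [add_apply, smul_apply, smul_eq_mul]
  ring

theorem dY_sq (hz : z ∈ U) (l : Fin n) : dY l (fun w => F w ^ 2) z
    = ∑ m, jac φ m l z.1 * dY m (fun w => F' w ^ 2) (tangentLift φ z) := by
  rw [← h.dY_comp hz h.reg'.sq]
  exact fderiv_apply_congr h.reg.isOpen hz (fun w hw => by rw [h.eq w hw]) _

theorem dX_sq (hz : z ∈ U) (l : Fin n) : dX l (fun w => F w ^ 2) z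
    = ∑ m, jac φ m l z.1 * dX m (fun w => F' w ^ 2) (tangentLift φ z)
      + ∑ a, (∑ k, z.2 k * hess φ a l k z.1) * dY a (fun w => F' w ^ 2) (tangentLift φ z) := by
  rw [← h.dX_comp hz h.reg'.sq]
  exact fderiv_apply_congr h.reg.isOpen hz (fun w hw => by rw [h.eq w hw]) _

/-- The direction `v` is left free: vertical `v` gives the rule of the metric, and `v` along the
base gives the mixed derivatives in the Euler-Lagrange expression. -/
theorem fderiv_dY_sq (hz : z ∈ U) (l : Fin n) (v : Coord n × Coord n) :
    fderiv ℝ (dY l (fun w => F w ^ 2)) z v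
      = ∑ m, (fderiv ℝ (fun w : Coord n × Coord n => jac φ m l w.1) z v
          * dY m (fun w => F' w ^ 2) (tangentLift φ z)
        + jac φ m l z.1
          * fderiv ℝ (fun w => dY m (fun w => F' w ^ 2) (tangentLift φ w)) z v) := by
  rw [fderiv_apply_congr h.reg.isOpen hz (fun w hw => h.dY_sq hw l)]
  exact fderiv_sum_mul _ (fun m _ => h.differentiableAt_jac hz m l)
    (fun m _ => h.differentiableAt_comp hz (contDiffOn_dY h.reg'.isOpen h.reg'.sq m)) v

/-- The transformation rule of the metric. -/
theorem metric (hz : z ∈ U) (i l : Fin n) : metric F i l z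
    = ∑ m, ∑ p, jac φ m l z.1 * jac φ p i z.1 * Finsler.metric F' p m (tangentLift φ z) := by
  have e := h.fderiv_dY_sq hz l (0, coordVec i)
  have e1 : ∀ m, fderiv ℝ (fun w : Coord n × Coord n => jac φ m l w.1) z (0, coordVec i) = 0 :=
    fun m => h.dY_jac hz m i l
  have e2 := fun m => h.dY_comp hz (contDiffOn_dY h.reg'.isOpen h.reg'.sq m) i
  simp only [dY] at e2
  simp only [Finsler.metric]
  simp only [dY] at e ⊢
  rw [e, Finset.mul_sum]
  refine Finset.sum_congr rfl fun m _ => ?_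
  rw [e1, e2, zero_mul, zero_add, Finset.mul_sum, Finset.mul_sum]
  exact Finset.sum_congr rfl fun p _ => by ring

/-- Raising an index is compatible with changes of coordinates. -/
theorem sum_jac_mul_metricInv (hz : z ∈ U) (Y : Fin n → ℝ) (a : Fin n) :
    ∑ i, jac φ a i z.1 * ∑ l, metricInv F i l z * ∑ m, jac φ m l z.1 * Y m
      = ∑ m, metricInv F' a m (tangentLift φ z) * Y m := by
  set P : Matrix (Fin n) (Fin n) ℝ := Matrix.of fun a i => jac φ a i z.1 with hP
  set g : Matrix (Fin n) (Fin n) ℝ := Matrix.of fun i j => Finsler.metric F i j z with hg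
  set g' : Matrix (Fin n) (Fin n) ℝ :=
    Matrix.of fun i j => Finsler.metric F' i j (tangentLift φ z) with hg'
  have hgg : g = P.transpose * (g' * P) := by
    ext i l
    simp only [hg, hg', hP, Matrix.mul_apply, Matrix.of_apply, Matrix.transpose_apply,
      h.metric hz, Finset.mul_sum]
    rw [Finset.sum_comm]
    exact Finset.sum_congr rfl fun p _ => Finset.sum_congr rfl fun m _ => by ring
  have h1 : g * g⁻¹ = 1 :=
    Matrix.mul_nonsing_inv g (isUnit_iff_ne_zero.2 (h.reg.det_ne z hz))
  -- From `g = Pᵀ g' P`. One-sided inverses of square matrices are two-sided, so the factor `Pᵀ` can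
  -- be moved to the right and `P g⁻¹ Pᵀ` inverts `g'`, without a separate proof that the Jacobian
  -- is invertible.
  have h2 : P.transpose * (g' * P * g⁻¹) = 1 := by
    rw [← mul_assoc, ← hgg, h1]
  have h3 : g' * (P * g⁻¹ * P.transpose) = 1 := by
    have := mul_eq_one_comm.1 h2
    rw [← this]; noncomm_ring
  have h4 : P * g⁻¹ * P.transpose = g'⁻¹ := (Matrix.inv_eq_right_inv h3).symm
  have h5 := congrFun (congrArg (fun X => X.mulVec Y) h4) a
  simp only [← Matrix.mulVec_mulVec] at h5
  exact h5

/-- The transformation rule of the Euler-Lagrange expression. -/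
theorem eulerLagrange (hz : z ∈ U) (l : Fin n) :
    (∑ k, z.2 k * dX k (dY l (fun w => F w ^ 2)) z) - dX l (fun w => F w ^ 2) z
      = ∑ m, jac φ m l z.1 * ((∑ p, (tangentLift φ z).2 p
            * dX p (dY m (fun w => F' w ^ 2)) (tangentLift φ z))
          - dX m (fun w => F' w ^ 2) (tangentLift φ z)
          + 2 * ∑ p, Finsler.metric F' m p (tangentLift φ z)
            * ∑ k, z.2 k * ∑ q, z.2 q * hess φ p k q z.1) := by
  have e : ∀ k, dX k (dY l (fun w => F w ^ 2)) z
      = ∑ m, (hess φ m l k z.1 * dY m (fun w => F' w ^ 2) (tangentLift φ z)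
        + jac φ m l z.1 * (∑ p, jac φ p k z.1 * dX p (dY m (fun w => F' w ^ 2)) (tangentLift φ z)
          + ∑ p, (∑ q, z.2 q * hess φ p k q z.1)
            * (2 * Finsler.metric F' m p (tangentLift φ z)))) := by
    intro k
    rw [dX, h.fderiv_dY_sq hz l]
    refine Finset.sum_congr rfl fun m _ => ?_
    have e1 := h.dX_jac hz m k l
    have e2 := h.dX_comp hz (contDiffOn_dY h.reg'.isOpen h.reg'.sq m) k
    have e3 : ∀ p, dY p (dY m (fun w => F' w ^ 2)) (tangentLift φ z)
        = 2 * Finsler.metric F' m p (tangentLift φ z) := fun p => by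
      rw [h.reg'.metric_symm (h.lift_mem z hz), Finsler.metric]; ring
    simp only [e3] at e2
    rw [dX] at e1 e2
    rw [e1, e2, h.hess_symm hz]
  simp only [e, h.dX_sq hz l, tangentLift_snd, Finset.mul_sum, Finset.sum_mul, mul_add, mul_sub,
    Finset.sum_add_distrib, Finset.sum_sub_distrib]
  -- These are the terms with first derivatives of `F'²`; they cancel against the second-derivative
  -- part of `∂F²/∂xˡ`.
  have s1 : ∑ k, ∑ m, z.2 k * (hess φ m l k z.1 * dY m (fun w => F' w ^ 2) (tangentLift φ z))
      = ∑ m, ∑ k, z.2 k * hess φ m l k z.1 * dY m (fun w => F' w ^ 2) (tangentLift φ z) := by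
    rw [Finset.sum_comm]
    exact Finset.sum_congr rfl fun _ _ => Finset.sum_congr rfl fun _ _ => by ring
  have s2 : ∑ k, ∑ m, ∑ p, z.2 k * (jac φ m l z.1
        * (jac φ p k z.1 * dX p (dY m (fun w => F' w ^ 2)) (tangentLift φ z)))
      = ∑ m, ∑ p, ∑ k, jac φ m l z.1
        * (z.2 k * jac φ p k z.1 * dX p (dY m (fun w => F' w ^ 2)) (tangentLift φ z)) := by
    rw [Finset.sum_comm]
    refine Finset.sum_congr rfl fun m _ => ?_
    rw [Finset.sum_comm]
    exact Finset.sum_congr rfl fun _ _ => Finset.sum_congr rfl fun _ _ => by ring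
  have s3 : ∑ k, ∑ m, ∑ p, ∑ q, z.2 k * (jac φ m l z.1
        * (z.2 q * hess φ p k q z.1 * (2 * Finsler.metric F' m p (tangentLift φ z))))
      = ∑ m, ∑ p, ∑ k, ∑ q, jac φ m l z.1
        * (2 * (Finsler.metric F' m p (tangentLift φ z)
          * (z.2 k * (z.2 q * hess φ p k q z.1)))) := by
    rw [Finset.sum_comm]
    refine Finset.sum_congr rfl fun m _ => ?_
    rw [Finset.sum_comm]
    exact Finset.sum_congr rfl fun _ _ => Finset.sum_congr rfl fun _ _ =>
      Finset.sum_congr rfl fun _ _ => by ring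
  rw [s1, s2, s3]
  ring

theorem sum_metricInv_mul_metric (hz : z ∈ U) (a : Fin n) (Q : Fin n → ℝ) :
    ∑ m, metricInv F' a m (tangentLift φ z)
      * ∑ p, Finsler.metric F' m p (tangentLift φ z) * Q p = Q a := by
  have e := Matrix.nonsing_inv_mul (Matrix.of fun i j => Finsler.metric F' i j (tangentLift φ z))
    (isUnit_iff_ne_zero.2 (h.reg'.det_ne _ (h.lift_mem z hz)))
  have := congrFun (congrArg (fun X => X.mulVec Q) e) a
  simp only [← Matrix.mulVec_mulVec, Matrix.one_mulVec] at this
  exact this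

/-- The transformation rule of the spray. -/
theorem spray (hz : z ∈ U) (a : Fin n) :
    ∑ i, jac φ a i z.1 * spray F i z = spray F' a (tangentLift φ z)
      + (1 / 2) * ∑ k, z.2 k * ∑ q, z.2 q * hess φ a k q z.1 := by
  have e : ∑ i, jac φ a i z.1 * Finsler.spray F i z
      = 1 / 4 * ∑ i, jac φ a i z.1 * ∑ l, metricInv F i l z
        * ((∑ k, z.2 k * dX k (dY l (fun w => F w ^ 2)) z) - dX l (fun w => F w ^ 2) z) := by
    rw [Finset.mul_sum]
    exact Finset.sum_congr rfl fun i _ => by rw [Finsler.spray]; ring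
  simp only [h.eulerLagrange hz] at e
  rw [e, h.sum_jac_mul_metricInv hz]
  simp only [mul_add, Finset.sum_add_distrib]
  -- Raising the index removes `g'` from the inhomogeneous term, and `1/4 * 2` leaves the
  -- coefficient `1/2`.
  have e2 := h.sum_metricInv_mul_metric hz a (fun p => ∑ k, z.2 k * ∑ q, z.2 q * hess φ p k q z.1)
  simp only at e2
  conv_rhs => rw [← e2]
  rw [Finsler.spray]
  congr 1
  rw [Finset.mul_sum, Finset.mul_sum]
  exact Finset.sum_congr rfl fun m _ => by ring

theorem contDiffOn_hess (a i j : Fin n) :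
    ContDiffOn ℝ ∞ (fun w : Coord n × Coord n => hess φ a i j w.1) U := by
  have h1 : ContDiffOn ℝ ∞ (fderiv ℝ (fderiv ℝ φ)) V :=
    h.contDiffOn_fderiv.fderiv_of_isOpen h.isOpen (by norm_num)
  have h2 : ContDiffOn ℝ ∞ (hess φ a i j) V :=
    (EuclideanSpace.proj a : Coord n →L[ℝ] ℝ).contDiff.comp_contDiffOn
      ((h1.clm_apply contDiffOn_const).clm_apply contDiffOn_const)
  exact h2.comp contDiffOn_fst h.fst_mem

theorem dY_hess (hz : z ∈ U) (a i j k : Fin n) :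
    dY k (fun w => hess φ a i j w.1) z = 0 := by
  have h1 : ContDiffOn ℝ ∞ (fderiv ℝ (fderiv ℝ φ)) V :=
    h.contDiffOn_fderiv.fderiv_of_isOpen h.isOpen (by norm_num)
  have h2 : ContDiffOn ℝ ∞ (hess φ a i j) V :=
    (EuclideanSpace.proj a : Coord n →L[ℝ] ℝ).contDiff.comp_contDiffOn
      ((h1.clm_apply contDiffOn_const).clm_apply contDiffOn_const)
  have h3 : HasFDerivAt (hess φ a i j) (fderiv ℝ (hess φ a i j) z.1) z.1 :=
    ((h2.contDiffAt (h.isOpen.mem_nhds (h.fst_mem z hz))).differentiableAt (by simp)).hasFDerivAt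
  have h4 := (HasFDerivAt.comp z h3 hasFDerivAt_fst).fderiv
  rw [Function.comp_def] at h4
  simp [dY, h4]

omit h in
theorem _root_.Finsler.dY_snd_apply (i k : Fin n) (z : Coord n × Coord n) :
    dY i (fun w => w.2 k) z = if k = i then 1 else 0 := by
  have : HasFDerivAt (fun w : Coord n × Coord n => w.2 k)
      ((EuclideanSpace.proj k : Coord n →L[ℝ] ℝ) ∘L
        ContinuousLinearMap.snd ℝ (Coord n) (Coord n)) z :=
    ((EuclideanSpace.proj k : Coord n →L[ℝ] ℝ) ∘L
        ContinuousLinearMap.snd ℝ (Coord n) (Coord n)).hasFDerivAt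
  simp [dY, this.fderiv, coordVec]

/-- Either factor `y` may be differentiated, with equal results by symmetry of the Hessian. The
resulting 2 cancels the `1/2` in the rule of the spray. -/
theorem dY_hess_quadratic (hz : z ∈ U) (a j : Fin n) :
    dY j (fun w => ∑ k, w.2 k * ∑ q, w.2 q * hess φ a k q w.1) z
      = 2 * ∑ k, z.2 k * hess φ a j k z.1 := by
  have hy : ∀ k, DifferentiableAt ℝ (fun w : Coord n × Coord n => w.2 k) z := fun k => by fun_prop
  have hh : ∀ k q, DifferentiableAt ℝ (fun w : Coord n × Coord n => hess φ a k q w.1) z :=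
    fun k q => h.reg.differentiableAt (h.contDiffOn_hess a k q) hz
  have e1 : ∀ k, fderiv ℝ (fun w : Coord n × Coord n => w.2 k) z (0, coordVec j)
      = if k = j then 1 else 0 := fun k => dY_snd_apply j k z
  have e2 : ∀ k q, fderiv ℝ (fun w : Coord n × Coord n => hess φ a k q w.1) z (0, coordVec j)
      = 0 := fun k q => h.dY_hess hz a k q j
  rw [dY, fderiv_sum_mul _ (fun k _ => hy k)
    (fun k _ => DifferentiableAt.fun_sum fun q _ => (hy q).fun_mul (hh k q))]
  simp only [fderiv_sum_mul _ (fun q _ => hy q) (fun q _ => hh _ q), e1, e2, mul_zero, add_zero,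
    ite_mul, one_mul, zero_mul, Finset.sum_add_distrib, Finset.sum_ite_eq', Finset.mem_univ,
    if_true]
  rw [two_mul]
  congr 1
  exact Finset.sum_congr rfl fun k _ => by rw [h.hess_symm hz]

/-- The transformation rule of the nonlinear connection. -/
theorem nonlin (hz : z ∈ U) (a j : Fin n) :
    ∑ i, jac φ a i z.1 * nonlin F i j z
      = ∑ q, jac φ q j z.1 * nonlin F' a q (tangentLift φ z)
        + ∑ k, z.2 k * hess φ a j k z.1 := by
  -- The rule is the `yʲ`-derivative of that of the spray; the Jacobian is constant along the
  -- fibres.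
  have e1 : dY j (fun w => ∑ i, jac φ a i w.1 * Finsler.spray F i w) z
      = ∑ i, jac φ a i z.1 * Finsler.nonlin F i j z := by
    rw [dY, fderiv_sum_mul _ (fun i _ => h.differentiableAt_jac hz a i)
      (fun i _ => h.reg.differentiableAt (h.reg.spray i) hz)]
    refine Finset.sum_congr rfl fun i _ => ?_
    rw [show fderiv ℝ (fun w : Coord n × Coord n => jac φ a i w.1) z (0, coordVec j) = 0 from
      h.dY_jac hz a j i, zero_mul, zero_add]
    rfl
  have hq : DifferentiableAt ℝ
      (fun w : Coord n × Coord n => ∑ k, w.2 k * ∑ q, w.2 q * hess φ a k q w.1) z := by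
    have hh : ∀ k q, DifferentiableAt ℝ (fun w : Coord n × Coord n => hess φ a k q w.1) z :=
      fun k q => h.reg.differentiableAt (h.contDiffOn_hess a k q) hz
    fun_prop
  rw [← e1, dY, fderiv_apply_congr h.reg.isOpen hz (fun w hw => h.spray hw a),
    fderiv_fun_add (h.differentiableAt_comp hz (h.reg'.spray a)) (hq.const_mul _),
    fderiv_const_mul hq, add_apply, smul_apply, smul_eq_mul]
  have e2 := h.dY_comp hz (h.reg'.spray a) j
  have e3 := h.dY_hess_quadratic hz a j
  rw [dY] at e2 e3
  rw [e2, e3]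
  simp only [Finsler.nonlin]
  ring

/-- The transformation rule of the horizontal derivative. -/
theorem delta_comp (hz : z ∈ U) (hf : ContDiffOn ℝ ∞ f U') (j : Fin n) :
    delta F j (fun w => f (tangentLift φ w)) z
      = ∑ a, jac φ a j z.1 * delta F' a f (tangentLift φ z) := by
  simp only [delta, h.dX_comp hz hf, h.dY_comp hz hf]
  -- The inhomogeneous part of the nonlinear connection is exactly the extra vertical term in
  -- `dX_comp`, so `δ_j` transforms like a covector.
  have e : ∑ k, Finsler.nonlin F k j z * ∑ a, jac φ a k z.1 * dY a f (tangentLift φ z)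
      = ∑ a, (∑ q, jac φ q j z.1 * Finsler.nonlin F' a q (tangentLift φ z)
        + ∑ k, z.2 k * hess φ a j k z.1) * dY a f (tangentLift φ z) := by
    simp only [← h.nonlin hz, Finset.mul_sum, Finset.sum_mul]
    rw [Finset.sum_comm]
    exact Finset.sum_congr rfl fun _ _ => Finset.sum_congr rfl fun _ _ => by ring
  have e' : ∑ q, ∑ a, jac φ q j z.1 * (Finsler.nonlin F' a q (tangentLift φ z)
        * dY a f (tangentLift φ z))
      = ∑ a, ∑ q, jac φ q j z.1 * Finsler.nonlin F' a q (tangentLift φ z)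
        * dY a f (tangentLift φ z) := by
    rw [Finset.sum_comm]
    exact Finset.sum_congr rfl fun _ _ => Finset.sum_congr rfl fun _ _ => by ring
  rw [e]
  simp only [add_mul, mul_sub, Finset.sum_add_distrib, Finset.sum_sub_distrib, Finset.sum_mul,
    Finset.mul_sum, e']
  ring

theorem delta_metric (hz : z ∈ U) (j i l : Fin n) :
    delta F j (Finsler.metric F i l) z
      = ∑ m, ∑ p, (hess φ m j l z.1 * jac φ p i z.1 * Finsler.metric F' p m (tangentLift φ z)
        + jac φ m l z.1 * hess φ p j i z.1 * Finsler.metric F' p m (tangentLift φ z)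
        + jac φ m l z.1 * jac φ p i z.1
          * ∑ q, jac φ q j z.1 * delta F' q (Finsler.metric F' p m) (tangentLift φ z)) := by
  have hj := fun m l => h.differentiableAt_jac hz m l
  have hg := fun p m => h.differentiableAt_comp hz (h.reg'.metric p m)
  rw [delta_congr_of_isOpen h.reg.isOpen hz (fun w hw => h.metric hw i l),
    delta_sum _ fun m _ => DifferentiableAt.fun_sum fun p _ =>
      ((hj m l).fun_mul (hj p i)).fun_mul (hg p m)]
  refine Finset.sum_congr rfl fun m _ => ?_
  rw [delta_sum _ fun p _ => ((hj m l).fun_mul (hj p i)).fun_mul (hg p m)]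
  refine Finset.sum_congr rfl fun p _ => ?_
  rw [delta_mul ((hj m l).fun_mul (hj p i)) (hg p m), delta_mul (hj m l) (hj p i),
    h.delta_jac hz, h.delta_jac hz, h.delta_comp hz (h.reg'.metric p m)]
  ring

/-- The transformation rule of the Christoffel symbols of the first kind. -/
theorem christoffel (hz : z ∈ U) (l j k : Fin n) :
    delta F j (Finsler.metric F l k) z + delta F k (Finsler.metric F j l) z
        - delta F l (Finsler.metric F j k) z
      = ∑ p, jac φ p l z.1 * ((∑ m, ∑ q, jac φ m k z.1 * jac φ q j z.1
          * (delta F' q (Finsler.metric F' p m) (tangentLift φ z)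
            + delta F' m (Finsler.metric F' q p) (tangentLift φ z)
            - delta F' p (Finsler.metric F' q m) (tangentLift φ z)))
        + 2 * ∑ m, Finsler.metric F' p m (tangentLift φ z) * hess φ m j k z.1) := by
  set P : Fin n → Fin n → ℝ := fun a i => jac φ a i z.1
  set H : Fin n → Fin n → Fin n → ℝ := fun a i j => hess φ a i j z.1
  set g : Fin n → Fin n → ℝ := fun p m => Finsler.metric F' p m (tangentLift φ z)
  set D : Fin n → Fin n → Fin n → ℝ :=
    fun q p m => delta F' q (Finsler.metric F' p m) (tangentLift φ z)
  have hH : ∀ a i j, H a i j = H a j i := fun a i j => h.hess_symm hz a i j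
  have hg : ∀ p m, g p m = g m p := fun p m => h.reg'.metric_symm (h.lift_mem z hz) p m
  -- `B` collects the second-derivative terms and `E` the tensorial ones. Of the six `B` terms in
  -- the Christoffel combination, symmetry in the first two arguments cancels four and leaves `2 * B
  -- j k l`.
  set B : Fin n → Fin n → Fin n → ℝ := fun j k l => ∑ m, ∑ p, H m j k * P p l * g p m with hB
  set E : Fin n → Fin n → Fin n → ℝ :=
    fun j l k => ∑ m, ∑ p, ∑ q, P m k * P p l * P q j * D q p m with hE
  have hBs : ∀ j k l, B j k l = B k j l := fun j k l => by simp only [hB, hH _ j k]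
  have hT : ∀ j l k, delta F j (Finsler.metric F l k) z = B j k l + B j l k + E j l k := by
    intro j l k
    have e1 : B j l k = ∑ m, ∑ p, P m k * H p j l * g p m := by
      simp only [hB]
      rw [Finset.sum_comm]
      exact Finset.sum_congr rfl fun _ _ => Finset.sum_congr rfl fun _ _ => by rw [hg]; ring
    rw [h.delta_metric hz, e1, hB, hE]
    simp only [← Finset.sum_add_distrib, Finset.mul_sum, ← mul_assoc]
    rfl
  have e1 : ∑ p, P p l * ∑ m, ∑ q, P m k * P q j * D q p m = E j l k := by
    simp only [hE, Finset.mul_sum]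
    rw [Finset.sum_comm]
    exact Finset.sum_congr rfl fun _ _ => Finset.sum_congr rfl fun _ _ =>
      Finset.sum_congr rfl fun _ _ => by ring
  have e2 : ∑ p, P p l * ∑ m, ∑ q, P m k * P q j * D m q p = E k j l := by
    simp only [hE, Finset.mul_sum]
    refine Finset.sum_congr rfl fun p _ => ?_
    rw [Finset.sum_comm]
    exact Finset.sum_congr rfl fun _ _ => Finset.sum_congr rfl fun _ _ => by ring
  have e3 : ∑ p, P p l * ∑ m, ∑ q, P m k * P q j * D p q m = E l j k := by
    simp only [hE, Finset.mul_sum]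
    rw [Finset.sum_comm]
    refine Finset.sum_congr rfl fun m _ => ?_
    rw [Finset.sum_comm]
    exact Finset.sum_congr rfl fun _ _ => Finset.sum_congr rfl fun _ _ => by ring
  have e4 : ∑ p, P p l * (2 * ∑ m, g p m * H m j k) = 2 * B j k l := by
    simp only [hB, Finset.mul_sum]
    rw [Finset.sum_comm]
    exact Finset.sum_congr rfl fun _ _ => Finset.sum_congr rfl fun _ _ => by ring
  have e5 : ∑ p, P p l * ((∑ m, ∑ q, P m k * P q j * (D q p m + D m q p - D p q m))
      + 2 * ∑ m, g p m * H m j k) = E j l k + E k j l - E l j k + 2 * B j k l := by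
    rw [← e1, ← e2, ← e3, ← e4]
    simp only [mul_add, mul_sub, Finset.sum_add_distrib, Finset.sum_sub_distrib]
  refine Eq.trans ?_ e5.symm
  rw [hT, hT, hT, hBs k l j, hBs k j l, hBs l j k]
  ring

/-- The transformation rule of the horizontal coefficients. -/
theorem horCoeff (hz : z ∈ U) (a j k : Fin n) :
    ∑ i, jac φ a i z.1 * horCoeff F i j k z
      = (∑ m, ∑ q, jac φ m k z.1 * jac φ q j z.1 * horCoeff F' a q m (tangentLift φ z))
        + hess φ a j k z.1 := by
  have e : ∑ i, jac φ a i z.1 * Finsler.horCoeff F i j k z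
      = 1 / 2 * ∑ i, jac φ a i z.1 * ∑ l, metricInv F i l z
        * (delta F j (Finsler.metric F l k) z + delta F k (Finsler.metric F j l) z
          - delta F l (Finsler.metric F j k) z) := by
    rw [Finset.mul_sum]
    exact Finset.sum_congr rfl fun i _ => by rw [Finsler.horCoeff]; ring
  simp only [h.christoffel hz] at e
  rw [e, h.sum_jac_mul_metricInv hz]
  simp only [mul_add (metricInv F' _ _ _), Finset.sum_add_distrib]
  have e2 := h.sum_metricInv_mul_metric hz a (fun m => hess φ m j k z.1)
  rw [← e2, mul_add]
  congr 1
  · simp only [Finsler.horCoeff, Finset.mul_sum]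
    rw [Finset.sum_comm]
    refine Finset.sum_congr rfl fun m _ => ?_
    rw [Finset.sum_comm]
    exact Finset.sum_congr rfl fun _ _ => Finset.sum_congr rfl fun _ _ => by ring
  · rw [Finset.mul_sum]
    exact Finset.sum_congr rfl fun _ _ => by ring

/-- The horizontal covariant derivative of a 1-form is tensorial. -/
theorem hCovLow_one (hz : z ∈ U) {A A' : LowComp n 1} (hA' : ∀ J, ContDiffOn ℝ ∞ (A' J) U')
    (hA : ∀ w ∈ U, ∀ i, A ![i] w = ∑ a, jac φ a i w.1 * A' ![a] (tangentLift φ w))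
    (l i : Fin n) :
    hCovLow F A ![l, i] z = ∑ q, ∑ a, jac φ q l z.1 * jac φ a i z.1
      * hCovLow F' A' ![q, a] (tangentLift φ z) := by
  simp only [Finsler.hCovLow_one]
  have hd : delta F l (A ![i]) z = ∑ a, (hess φ a l i z.1 * A' ![a] (tangentLift φ z)
      + jac φ a i z.1 * ∑ q, jac φ q l z.1 * delta F' q (A' ![a]) (tangentLift φ z)) := by
    have hj := fun a => h.differentiableAt_jac hz a i
    have hc := fun a => h.differentiableAt_comp hz (hA' ![a])
    rw [delta_congr_of_isOpen h.reg.isOpen hz (fun w hw => hA w hw i),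
      delta_sum _ fun a _ => (hj a).fun_mul (hc a)]
    refine Finset.sum_congr rfl fun a _ => ?_
    rw [delta_mul (hj a) (hc a), h.delta_jac hz, h.delta_comp hz (hA' _)]
  -- The Hessian term produced here by the horizontal coefficients is the one produced in `hd` by
  -- differentiating the Jacobian; the difference is tensorial.
  have hs : ∑ m, Finsler.horCoeff F m i l z * A ![m] z
      = ∑ a, ((∑ m, ∑ q, jac φ m l z.1 * jac φ q i z.1
          * Finsler.horCoeff F' a q m (tangentLift φ z)) + hess φ a l i z.1)
        * A' ![a] (tangentLift φ z) := by
    have e : ∀ a, hess φ a l i z.1 = hess φ a i l z.1 := fun a => h.hess_symm hz a l i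
    simp only [e, ← h.horCoeff hz, hA z hz, Finset.mul_sum, Finset.sum_mul]
    rw [Finset.sum_comm]
    exact Finset.sum_congr rfl fun _ _ => Finset.sum_congr rfl fun _ _ => by ring
  rw [hd, hs]
  simp only [add_mul, mul_sub, Finset.mul_sum, Finset.sum_mul, Finset.sum_add_distrib,
    Finset.sum_sub_distrib]
  have e1 : ∑ a, ∑ q, jac φ a i z.1 * (jac φ q l z.1 * delta F' q (A' ![a]) (tangentLift φ z))
      = ∑ q, ∑ a, jac φ q l z.1 * jac φ a i z.1 * delta F' q (A' ![a]) (tangentLift φ z) := by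
    rw [Finset.sum_comm]
    exact Finset.sum_congr rfl fun _ _ => Finset.sum_congr rfl fun _ _ => by ring
  have e2 : ∑ a, ∑ m, ∑ q, jac φ m l z.1 * jac φ q i z.1
        * Finsler.horCoeff F' a q m (tangentLift φ z) * A' ![a] (tangentLift φ z)
      = ∑ q, ∑ a, ∑ m, jac φ q l z.1 * jac φ a i z.1
        * (Finsler.horCoeff F' m a q (tangentLift φ z) * A' ![m] (tangentLift φ z)) := by
    rw [Finset.sum_comm]
    refine Finset.sum_congr rfl fun m _ => ?_
    rw [Finset.sum_comm]
    exact Finset.sum_congr rfl fun _ _ => Finset.sum_congr rfl fun _ _ => by ring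
  rw [e1, e2]
  ring

end IsTransition

end Transition

/-! ## Charts of a Finsler manifold -/

section Manifold

variable {M : Type*} [TopologicalSpace M] [ChartedSpace (Coord n) M]

/-- Coordinate changes give base points that are equal only propositionally. Since every tangent
space is the model space by definition, vectors over them are compared there. -/
theorem tangentBundle_mk_congr {x x' : M} (hx : x = x') {v : TangentSpace (𝓡 n) x}
    {v' : TangentSpace (𝓡 n) x'} (hv : (show Coord n from v) = v') :
    (⟨x, v⟩ : TangentBundle (𝓡 n) M) = ⟨x', v'⟩ := by
  subst hx
  exact congrArg _ hv

theorem PiForm.toFun_congr {s : ℕ} (A : PiForm n M s) {x x' : M} (hx : x = x')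
    {y : TangentSpace (𝓡 n) x} {y' : TangentSpace (𝓡 n) x'} (hy : (show Coord n from y) = y')
    {v : Fin s → TangentSpace (𝓡 n) x} {v' : Fin s → TangentSpace (𝓡 n) x'}
    (hv : ∀ a, (show Coord n from v a) = v' a) : A.toFun x y v = A.toFun x' y' v' := by
  subst hx
  obtain rfl : y = y' := hy
  obtain rfl : v = v' := funext hv
  rfl

variable {e e' : OpenPartialHomeomorph M (Coord n)}

omit [ChartedSpace (Coord n) M] in
theorem isOpen_slit (e : OpenPartialHomeomorph M (Coord n)) : IsOpen (slit e) :=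
  e.open_target.prod isOpen_ne

theorem chartVec_smul (e : OpenPartialHomeomorph M (Coord n)) (x y : Coord n) (c : ℝ) :
    chartVec e x (c • y) = c • chartVec e x y :=
  map_smul (mfderiv 𝓘(ℝ, Coord n) (𝓡 n) e.symm x) c y

/-- The domain of the change of coordinates `e' ∘ e⁻¹`. -/
abbrev overlap (e e' : OpenPartialHomeomorph M (Coord n)) : Set (Coord n) :=
  (e.symm.trans e').source

/-- A degenerate metric would have a kernel vector, on which the quadratic form vanishes, against
positive definiteness. -/
theorem FinslerStructure.isRegular (F : FinslerStructure n M) (he : e ∈ Charts n M) :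
    IsRegular (F.loc e) (slit e) where
  isOpen := isOpen_slit e
  smooth := F.smooth e he
  det_ne z hz hdet := by
    obtain ⟨v, hv, h0⟩ := Matrix.exists_mulVec_eq_zero_iff.2 hdet
    have hpos := F.posDef e he z hz v hv
    have : ∑ i, ∑ j, metric (localExpr F.L e) i j z * v i * v j = 0 := by
      refine Finset.sum_eq_zero fun i _ => ?_
      have hi : ∑ j, metric (localExpr F.L e) i j z * v j = 0 := congrFun h0 i
      calc ∑ j, metric (localExpr F.L e) i j z * v i * v j
          = v i * ∑ j, metric (localExpr F.L e) i j z * v j := by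
            rw [Finset.mul_sum]
            exact Finset.sum_congr rfl fun j _ => by ring
        _ = 0 := by rw [hi, mul_zero]
    exact hpos.ne' this

theorem IsRegular.mono {F : Coord n × Coord n → ℝ} {U U₀ : Set (Coord n × Coord n)}
    (h : IsRegular F U) (hU : IsOpen U₀) (hs : U₀ ⊆ U) : IsRegular F U₀ :=
  ⟨hU, h.smooth.mono hs, fun z hz => h.det_ne z (hs hz)⟩

theorem mdifferentiable_of_mem_charts (he : e ∈ Charts n M) :
    e.MDifferentiable (𝓡 n) (𝓡 n) :=
  ⟨(contMDiffOn_of_mem_maximalAtlas he).mdifferentiableOn (by simp),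
    (contMDiffOn_symm_of_mem_maximalAtlas he).mdifferentiableOn (by simp)⟩

theorem mfderiv_chartVec (he : e ∈ Charts n M) {x : Coord n} (hx : x ∈ e.target) (y : Coord n) :
    mfderiv (𝓡 n) (𝓡 n) e (e.symm x) (chartVec e x y) = y :=
  DFunLike.congr_fun ((mdifferentiable_of_mem_charts he).comp_symm_deriv hx) y

theorem chartVec_ne_zero (he : e ∈ Charts n M) {x : Coord n} (hx : x ∈ e.target) {y : Coord n}
    (hy : y ≠ 0) : chartVec e x y ≠ 0 := fun h0 => hy (by
  have := mfderiv_chartVec he hx y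
  rw [h0, map_zero] at this
  exact this.symm)

theorem fderiv_transition (he : e ∈ Charts n M) (he' : e' ∈ Charts n M) {x : Coord n}
    (hx : x ∈ overlap e e') (y : Coord n) :
    fderiv ℝ (e' ∘ e.symm) x y = mfderiv (𝓡 n) (𝓡 n) e' (e.symm x) (chartVec e x y) := by
  have h1 : MDifferentiableAt (𝓡 n) (𝓡 n) e.symm x :=
    (mdifferentiable_of_mem_charts he).mdifferentiableAt_symm (by simpa using hx.1)
  have h2 : MDifferentiableAt (𝓡 n) (𝓡 n) e' (e.symm x) :=
    (mdifferentiable_of_mem_charts he').mdifferentiableAt (by simpa using hx.2)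
  rw [← mfderiv_eq_fderiv, mfderiv_comp x h2 h1]
  rfl

omit [ChartedSpace (Coord n) M] in
theorem symm_transition {x : Coord n} (hx : x ∈ overlap e e') :
    e'.symm ((e' ∘ e.symm) x) = e.symm x :=
  e'.left_inv (by simpa using hx.2)

/-- Chain rule for `e' ∘ e⁻¹`, followed by cancelling the differential of `e'` with that of its
inverse. -/
theorem chartVec_transition (he : e ∈ Charts n M) (he' : e' ∈ Charts n M) {x : Coord n}
    (hx : x ∈ overlap e e') (y : Coord n) :
    (show Coord n from chartVec e x y)
      = chartVec e' ((e' ∘ e.symm) x) (fderiv ℝ (e' ∘ e.symm) x y) := by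
  rw [fderiv_transition he he' hx]
  exact (DFunLike.congr_fun ((mdifferentiable_of_mem_charts he').symm_comp_deriv
    (x := e.symm x) (by simpa using hx.2)) (chartVec e x y)).symm

omit [ChartedSpace (Coord n) M] in
theorem transition_mem_target {x : Coord n} (hx : x ∈ overlap e e') :
    (e' ∘ e.symm) x ∈ e'.target :=
  e'.map_source (by simpa using hx.2)

theorem FinslerStructure.isTransition (F : FinslerStructure n M) (he : e ∈ Charts n M)
    (he' : e' ∈ Charts n M) :
    IsTransition (e' ∘ e.symm) (overlap e e') (F.loc e)
      (overlap e e' ×ˢ {y | y ≠ 0}) (F.loc e') (slit e') where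
  isOpen := (e.symm.trans e').open_source
  smooth := by
    have h : ContMDiffOn (𝓡 n) (𝓡 n) ∞ (e' ∘ e.symm) (overlap e e') :=
      (contMDiffOn_of_mem_maximalAtlas he').comp
        ((contMDiffOn_symm_of_mem_maximalAtlas he).mono fun x hx => by simpa using hx.1)
        fun x hx => by simpa using hx.2
    exact h.contDiffOn
  reg := (F.isRegular he).mono ((e.symm.trans e').open_source.prod isOpen_ne)
    (Set.prod_mono (fun x hx => by simpa using hx.1) subset_rfl)
  reg' := F.isRegular he'
  fst_mem z hz := hz.1
  lift_mem z hz := ⟨transition_mem_target hz.1, fun h0 => by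
    have h1 : chartVec e z.1 z.2 ≠ 0 := chartVec_ne_zero he (by simpa using hz.1.1) hz.2
    have h2 := chartVec_transition he he' hz.1 z.2
    change fderiv ℝ (e' ∘ e.symm) z.1 z.2 = 0 at h0
    rw [h0] at h2
    exact h1 (h2.trans (map_zero (mfderiv 𝓘(ℝ, Coord n) (𝓡 n) e'.symm _)))⟩
  eq z hz := congrArg F.L
    (tangentBundle_mk_congr (symm_transition hz.1).symm (chartVec_transition he he' hz.1 z.2))

theorem PiForm.comp_transition (A : PiForm n M 1) (he : e ∈ Charts n M) (he' : e' ∈ Charts n M)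
    {z : Coord n × Coord n} (hz : z.1 ∈ overlap e e') (i : Fin n) :
    A.comp e ![i] z = ∑ a, jac (e' ∘ e.symm) a i z.1
      * A.comp e' ![a] (tangentLift (e' ∘ e.symm) z) := by
  set φ := e' ∘ e.symm
  let W : Coord n →ₗ[ℝ] TangentSpace (𝓡 n) (e'.symm (φ z.1)) :=
    (mfderiv 𝓘(ℝ, Coord n) (𝓡 n) e'.symm (φ z.1)).toLinearMap
  let f := A.toFun (e'.symm (φ z.1)) (chartVec e' (φ z.1) (fderiv ℝ φ z.1 z.2))
  -- With the base vector frozen, the form becomes a linear functional on coordinates. The default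
  -- tuple `0` plays no role, since its only slot is overwritten.
  let g : Coord n →ₗ[ℝ] ℝ := (f.toLinearMap 0 0).comp W
  have hg : ∀ v, g v = f fun _ => W v := fun v => congrArg f (by
    funext b
    rw [Subsingleton.elim b 0]
    simp)
  have h1 : A.comp e ![i] z = g (fderiv ℝ φ z.1 (coordVec i)) := by
    rw [hg]
    exact A.toFun_congr (symm_transition hz).symm (chartVec_transition he he' hz z.2)
      fun b => by
        rw [Subsingleton.elim b 0]
        exact chartVec_transition he he' hz _
  have h2 : ∀ a, A.comp e' ![a] (tangentLift φ z) = g (coordVec a) := fun a => by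
    rw [hg]
    exact congrArg f (by
      funext b
      rw [Subsingleton.elim b 0]
      rfl)
  rw [h1, coord_eq_sum (fderiv ℝ φ z.1 (coordVec i)), map_sum]
  simp only [map_smul, smul_eq_mul, h2, jac]

theorem FinslerStructure.isHomogAt (F : FinslerStructure n M) (he : e ∈ Charts n M) {c : ℝ}
    (hc : 0 < c) : IsHomogAt (F.loc e) (slit e) c where
  reg := F.isRegular he
  pos := hc
  mem z hz := ⟨hz.1, smul_ne_zero hc.ne' hz.2⟩
  eq z hz := by
    change F.L ⟨_, chartVec e z.1 (c • z.2)⟩ = _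
    rw [chartVec_smul, F.homog _ _ _ hc]
    rfl

theorem PiForm.comp_smul {s : ℕ} (A : PiForm n M s) (he : e ∈ Charts n M) {c : ℝ} (hc : 0 < c)
    (J : Fin s → Fin n) {z : Coord n × Coord n} (hz : z ∈ slit e) :
    A.comp e J (z.1, c • z.2) = A.comp e J z := by
  simp only [PiForm.comp, chartVec_smul]
  rw [A.homog _ _ _ (chartVec_ne_zero he hz.1 hz.2) hc]

/-! ## The form `∇ʰA + A ⊗ A` -/

/-- The components of `∇ʰA + A ⊗ A`. -/
def covAddSq (F : Coord n × Coord n → ℝ) (A : LowComp n 1) : LowComp n 2 := fun J z =>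
  hCovLow F A ![J 0, J 1] z + A ![J 0] z * A ![J 1] z

theorem covAddSq_transition (F : FinslerStructure n M) (A : PiForm n M 1) (he : e ∈ Charts n M)
    (he' : e' ∈ Charts n M) {z : Coord n × Coord n} (hz : z.1 ∈ overlap e e') (hy : z.2 ≠ 0)
    (J : Fin 2 → Fin n) :
    covAddSq (F.loc e) (A.comp e) J z = ∑ q, ∑ a,
      jac (e' ∘ e.symm) q (J 0) z.1 * jac (e' ∘ e.symm) a (J 1) z.1
        * covAddSq (F.loc e') (A.comp e') ![q, a] (tangentLift (e' ∘ e.symm) z) := by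
  have h := (F.isTransition he he').hCovLow_one (z := z) ⟨hz, hy⟩ (A := A.comp e)
    (A' := A.comp e') (fun J => A.smooth e' he' J)
    (fun w hw i => A.comp_transition he he' hw.1 i) (J 0) (J 1)
  simp only [covAddSq, h, A.comp_transition he he' hz, Finset.sum_mul_sum, mul_add,
    Finset.sum_add_distrib, Matrix.cons_val_zero, Matrix.cons_val_one]
  congr 1
  exact Finset.sum_congr rfl fun _ _ => Finset.sum_congr rfl fun _ _ => by ring

/-- The coordinates of a tangent vector at `x` in the preferred chart at `x`. -/
def prefCoord (x : M) : TangentSpace (𝓡 n) x →L[ℝ] Coord n :=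
  mfderiv (𝓡 n) (𝓡 n) (chartAt (Coord n) x) x

/-- The value of `∇ʰA + A ⊗ A` at a nonzero tangent vector, computed in the preferred chart. -/
def covAddSqFun (F : FinslerStructure n M) (A : PiForm n M 1) (x : M)
    (y : TangentSpace (𝓡 n) x) :
    MultilinearMap ℝ (fun _ : Fin 2 => TangentSpace (𝓡 n) x) ℝ :=
  ∑ q, ∑ a, covAddSq (F.loc (chartAt (Coord n) x)) (A.comp (chartAt (Coord n) x)) ![q, a]
      (chartAt (Coord n) x x, prefCoord x y) •
    (MultilinearMap.mkPiAlgebra ℝ (Fin 2) ℝ).compLinearMap fun b =>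
      ((EuclideanSpace.proj (![q, a] b) : Coord n →L[ℝ] ℝ) ∘L prefCoord x).toLinearMap

variable [IsManifold (𝓡 n) ∞ M]

/-- The preferred chart changes with the point, so smoothness is not visible from the definition of
`covAddSqFun`. Tensoriality removes the dependence: near any point the values may be read in one
fixed chart. -/
theorem covAddSqFun_chart (F : FinslerStructure n M) (A : PiForm n M 1) (he : e ∈ Charts n M)
    {z : Coord n × Coord n} (hz : z ∈ slit e) (J : Fin 2 → Fin n) :
    covAddSqFun F A (e.symm z.1) (chartVec e z.1 z.2) (fun b => chartVec e z.1 (coordVec (J b)))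
      = covAddSq (F.loc e) (A.comp e) J z := by
  set e' := chartAt (Coord n) (e.symm z.1)
  have hmem : e' ∈ Charts n M := IsManifold.chart_mem_maximalAtlas _
  have hx : z.1 ∈ overlap e e' := by
    rw [overlap, OpenPartialHomeomorph.trans_source]
    exact ⟨by simpa using hz.1, mem_chart_source (Coord n) (e.symm z.1)⟩
  have hp : ∀ y, prefCoord (e.symm z.1) (chartVec e z.1 y) = fderiv ℝ (e' ∘ e.symm) z.1 y :=
    fun y => (fderiv_transition he hmem hx y).symm
  rw [covAddSq_transition F A he hmem hx hz.2, covAddSqFun]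
  simp only [sum_apply, smul_apply,
    MultilinearMap.compLinearMap_apply, MultilinearMap.mkPiAlgebra_apply, Fin.prod_univ_two,
    smul_eq_mul]
  refine Finset.sum_congr rfl fun q _ => Finset.sum_congr rfl fun a _ => ?_
  rw [mul_comm]
  congr 1
  · exact congrArg₂ (· * ·) (congrArg (fun v : Coord n => v q) (hp _))
      (congrArg (fun v : Coord n => v a) (hp _))
  · rw [hp]
    rfl

/-- The scalar 2-form `∇ʰA + A ⊗ A`. -/
def covAddSqForm (F : FinslerStructure n M) (A : PiForm n M 1) : PiForm n M 2 where
  toFun := covAddSqFun F A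
  homog x y c hy hc := by
    have he : chartAt (Coord n) x ∈ Charts n M := IsManifold.chart_mem_maximalAtlas _
    have hx := mem_chart_source (Coord n) x
    have hz : (chartAt (Coord n) x x, prefCoord x y) ∈ slit (chartAt (Coord n) x) := by
      -- The differential of a chart is injective, so nonzero vectors have nonzero coordinates.
      refine ⟨mem_chart_target (Coord n) x, fun h0 => hy ?_⟩
      have := DFunLike.congr_fun ((mdifferentiable_of_mem_charts he).symm_comp_deriv hx) y
      refine this.symm.trans ?_
      change mfderiv (𝓡 n) (𝓡 n) (chartAt (Coord n) x).symm _ (prefCoord x y) = 0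
      rw [show prefCoord x y = 0 from h0]
      exact map_zero _
    have h := F.isHomogAt he hc
    have h1 : ∀ J, ∀ w ∈ slit (chartAt (Coord n) x), A.comp (chartAt (Coord n) x) J (w.1, c • w.2)
        = A.comp (chartAt (Coord n) x) J w := fun J w hw => A.comp_smul he hc J hw
    have h2 : ∀ J, covAddSq (F.loc (chartAt (Coord n) x)) (A.comp (chartAt (Coord n) x)) J
          (chartAt (Coord n) x x, c • prefCoord x y)
        = covAddSq (F.loc (chartAt (Coord n) x)) (A.comp (chartAt (Coord n) x)) J
          (chartAt (Coord n) x x, prefCoord x y) := fun J => by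
      simp only [covAddSq]
      exact congrArg₂ (· + ·)
        (h.hCovLow (T := A.comp _) (fun J => A.smooth _ he J) h1 _ _ hz)
        (congrArg₂ (· * ·) (h1 _ _ hz) (h1 _ _ hz))
    simp only [covAddSqFun, map_smul, h2]
  smooth e he J := by
    have hA : ∀ J, ContDiffOn ℝ ∞ (A.comp e J) (slit e) := fun J => A.smooth e he J
    have : ContDiffOn ℝ ∞ (covAddSq (F.loc e) (A.comp e) J) (slit e) :=
      ((F.isRegular he).hCovLow hA _).add ((hA _).mul (hA _))
    exact this.congr fun z hz => covAddSqFun_chart F A he hz J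

theorem covAddSqForm_comp (F : FinslerStructure n M) (A : PiForm n M 1) (he : e ∈ Charts n M)
    {z : Coord n × Coord n} (hz : z ∈ slit e) (k l : Fin n) :
    (covAddSqForm F A).comp e ![k, l] z
      = hCovLow (F.loc e) (A.comp e) ![k, l] z + A.comp e ![k] z * A.comp e ![l] z :=
  covAddSqFun_chart F A he hz ![k, l]

theorem covAddSqForm_nonZero (F : FinslerStructure n M) (A : PiForm n M 1)
    (h : F.CovAddSqNonZero A) : (covAddSqForm F A).NonZero := by
  obtain ⟨e, he, z, hz, i, j, hne⟩ := h
  refine ⟨e.symm z.1, chartVec e z.1 z.2, chartVec_ne_zero he hz.1 hz.2, fun h0 => hne ?_⟩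
  rw [← covAddSqForm_comp F A he hz, PiForm.comp, h0, zero_apply]

end Manifold

/-! ## Recurrent Finsler manifolds -/

section Recurrent

variable {M : Type*} [TopologicalSpace M] [ChartedSpace (Coord n) M]
  {e : OpenPartialHomeomorph M (Coord n)} {F : FinslerStructure n M} {A : PiForm n M 1}

/-- The factor `A_l` does not involve the contracted index, so it leaves the trace. Stated apart
from `RicNonZero` because part (b) also needs it. -/
theorem FinslerStructure.IsRecurrent.hCovLow_ric (hA : F.IsRecurrent A) (he : e ∈ Charts n M)
    {z : Coord n × Coord n} (hz : z ∈ slit e) (l : Fin n) (J : Fin 2 → Fin n) :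
    hCovLow (F.loc e) (ric (F.loc e)) (Fin.cons l J) z
      = A.comp e ![l] z * ric (F.loc e) J z := by
  rw [eq_vec2 J, Finsler.hCovLow_ric (F.isRegular he) hz]
  simp only [hA.eq e he z hz]
  rw [ric, Finset.mul_sum]
  rfl

theorem FinslerStructure.IsRecurrent.isRicciRecurrent (hA : F.IsRecurrent A)
    (hr : F.RicNonZero) : F.IsRicciRecurrent A :=
  ⟨hA.dim, hr, hA.form_ne, fun _ he _ hz l J => hA.hCovLow_ric he hz l J⟩

theorem FinslerStructure.IsRecurrent.isConcircRecurrent (hA : F.IsRecurrent A)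
    (hC : F.ConcircNonZero) : F.IsConcircRecurrent A :=
  ⟨hA.dim, hC, hA.form_ne, fun e he z hz i l J =>
    hCovMix_concirc_of_recurrent (F.isRegular he) hz l (fun i J => hA.eq e he z hz i l J)
      (delta_scal_of_recurrent (F.isRegular he) hz l fun a b => hA.hCovLow_ric he hz l ![a, b])
      i J⟩

variable [IsManifold (𝓡 n) ∞ M]

theorem FinslerStructure.IsRecurrent.isTwoRecurrent (hA : F.IsRecurrent A)
    (h : F.CovAddSqNonZero A) : F.IsTwoRecurrent (covAddSqForm F A) :=
  ⟨hA.dim, hA.curv_ne, covAddSqForm_nonZero F A h, fun e he z hz i k l J => by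
    rw [covAddSqForm_comp F A he hz]
    exact hCovMix_hCovMix_of_recurrent (F.isRegular he) (F.isRegular he).hCurv
      (fun J => A.smooth e he J) (fun w hw => hA.eq e he w hw) hz i k l J⟩

theorem FinslerStructure.IsRecurrent.isTwoRicciRecurrent (hA : F.IsRecurrent A)
    (h : F.CovAddSqNonZero A) (hr : F.RicNonZero) : F.IsTwoRicciRecurrent (covAddSqForm F A) :=
  ⟨hA.dim, hr, covAddSqForm_nonZero F A h, fun e he z hz k l J => by
    rw [covAddSqForm_comp F A he hz]
    exact hCovLow_hCovLow_of_recurrent (F.isRegular he) (F.isRegular he).ric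
      (fun J => A.smooth e he J) (fun w hw => hA.hCovLow_ric he hw) hz k l J⟩

end Recurrent

end Finsler

end

theorem mainTheorem5 {n : ℕ} (hn : 3 ≤ n) {M : Type*} [TopologicalSpace M]
    [ChartedSpace (EuclideanSpace ℝ (Fin n)) M] [IsManifold (𝓡 n) ∞ M]
    (F : Finsler.FinslerStructure n M) (A : Finsler.PiForm n M 1) (hA : F.IsRecurrent A) :
    (F.RicNonZero → F.IsRicciRecurrent A) ∧
    (F.ScalNonZero → F.ConcircNonZero → F.IsConcircRecurrent A) ∧
    (F.CovAddSqNonZero A →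
      ∃ α : Finsler.PiForm n M 2,
        F.IsTwoRecurrent α ∧ (F.RicNonZero → F.IsTwoRicciRecurrent α)) :=
  ⟨hA.isRicciRecurrent, fun _ => hA.isConcircRecurrent, fun h =>
    ⟨Finsler.covAddSqForm F A, hA.isTwoRecurrent h, hA.isTwoRicciRecurrent h⟩⟩
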